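/- Let $\Gamma$ be a connected graph with finitely many vertices, let $\mathcal G$ be a graph of groups over $\Gamma$ whose vertex groups are free of finite rank and whose edge groups are finitely generated, let $G$ be its fundamental group (formed with respect to a spanning tree of $\Gamma$), and let $T$ be its Bass–Serre tree. Write $G_v\le G$ for the vertex groups ($v\in V(\Gamma)$), $G_{\tilde v}$ for the stabilizer in $G$ of a vertex $\tilde v$ of $T$, and, for a finite path $\rho$ in $T$ (without backtracking), $\mathrm{Stab}(\rho)$ for its pointwise stabilizer, i.e. the intersection of the stabilizers of its edges. One says that $(G,\{G_v\}_{v\in V(\Gamma)})$ has *finite stature* if for each $v\in V(\Gamma)$ there are only finitely many $G_v$-conjugacy classes of infinite subgroups of the form $G_v\cap C$, where $C$ is an intersection of (possibly infinitely many) $G$-conjugates of members of $\{G_u\}_{u\in V(\Gamma)}$. Then $(G,\{G_v\}_{v\in V(\Gamma)})$ has finite stature if and only if there are only finitely many $G$-conjugacy classes of groups of the form $G_{\tilde v}\cap\mathrm{Stab}(\rho)$, where $\tilde v$ is a vertex of $T$, $\rho$ is a finite path in $T$ passing through $\tilde v$, and $G_{\tilde v}\cap\mathrm{Stab}(\rho)$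 is considered as a subgroup of the vertex stabilizer $G_{\tilde v}$. That is, $G$ has only finitely many orbits on the set of pairs $(\tilde v,\,G_{\tilde v}\cap\mathrm{Stab}(\rho))$ under $g\cdot(\tilde v,K)=(g\tilde v,\,gKg^{-1})$; equivalently, for each of finitely many representatives $\tilde v$ of the $G$-orbits of vertices of $T$, there are only finitely many $G_{\tilde v}$-conjugacy classes of such subgroups of $G_{\tilde v}$. -/

import Mathlib

noncomputable section

/-- A graph (loops and multiple edges allowed): `V` is the set of vertices and `E` the set of
geometric edges, each of which carries a reference orientation from `src e` to `tgt e`. -/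
structure OrientedGraph (V : Type*) (E : Type*) where
  src : E → V
  tgt : E → V

namespace OrientedGraph

variable {V E : Type*} (Γ : OrientedGraph V E)

/-- The initial vertex of an edge traversed along (`true`) or against (`false`) its reference
orientation. -/
def dartStart (d : E × Bool) : V := if d.2 then Γ.src d.1 else Γ.tgt d.1

/-- The terminal vertex of an edge traversed along (`true`) or against (`false`) its reference
orientation. -/
def dartEnd (d : E × Bool) : V := if d.2 then Γ.tgt d.1 else Γ.src d.1

/-- `l` is a finite edge path from `x` to `y`. -/
def IsWalk : V → List (E × Bool) → V → Prop
  | x, [], y => x = y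
  | x, d :: l, y => Γ.dartStart d = x ∧ IsWalk (Γ.dartEnd d) l y

/-- `l` is a finite path from `x` to `y`: an edge path without backtracking, i.e. no edge is
followed immediately by the same edge traversed in the opposite direction. -/
def IsPath (x : V) (l : List (E × Bool)) (y : V) : Prop :=
  Γ.IsWalk x l y ∧ l.IsChain (fun a b => a.1 = b.1 → a.2 = b.2)

/-- The vertices of the path `l` starting at `x`. -/
def support (x : V) (l : List (E × Bool)) : List V := x :: l.map Γ.dartEnd

/-- The subgraph with all vertices and with edge set `S` is a tree: any two vertices are joined by
exactly one path (without backtracking) that uses only edges of `S`. -/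
def IsSpanningTree (S : Set E) : Prop :=
  Nonempty V ∧ ∀ x y : V, ∃! l : List (E × Bool), Γ.IsPath x l y ∧ ∀ d ∈ l, d.1 ∈ S

end OrientedGraph

/-- A graph of groups with underlying graph `Γ`: vertex groups, edge groups, and injective
homomorphisms of each edge group into the vertex groups at the two ends of the edge. -/
structure GraphOfGroups {V E : Type*} (Γ : OrientedGraph V E) where
  vertexGroup : V → Type*
  edgeGroup : E → Type*
  [vertexGroupInst : ∀ v, Group (vertexGroup v)]
  [edgeGroupInst : ∀ e, Group (edgeGroup e)]
  srcHom : ∀ e, edgeGroup e →* vertexGroup (Γ.src e)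
  tgtHom : ∀ e, edgeGroup e →* vertexGroup (Γ.tgt e)
  srcHom_injective : ∀ e, Function.Injective (srcHom e)
  tgtHom_injective : ∀ e, Function.Injective (tgtHom e)

namespace GraphOfGroups

attribute [instance] vertexGroupInst edgeGroupInst

variable {V E : Type*} {Γ : OrientedGraph V E} (𝒢 : GraphOfGroups Γ) (S : Set E)

/-- The free product of all vertex groups and of the free group on the stable letters `t e`,
one for each edge `e`. -/
abbrev PreGroup : Type _ := Monoid.Coprod (Monoid.CoprodI 𝒢.vertexGroup) (FreeGroup E)

/-- A vertex group inside the free product. -/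
def preVertexHom (v : V) : 𝒢.vertexGroup v →* 𝒢.PreGroup :=
  Monoid.Coprod.inl.comp Monoid.CoprodI.of

/-- A stable letter inside the free product. -/
def preLetter (e : E) : 𝒢.PreGroup := Monoid.Coprod.inr (FreeGroup.of e)

/-- The relators of the fundamental group: `t e * (c at tgt e) * (t e)⁻¹ = (c at src e)` for `c` in
the edge group of `e`, and `t e = 1` for `e` in the spanning tree `S`. -/
def relators : Set 𝒢.PreGroup :=
  {r | ∃ (e : E) (c : 𝒢.edgeGroup e),
      r = 𝒢.preLetter e * 𝒢.preVertexHom (Γ.tgt e) (𝒢.tgtHom e c) * (𝒢.preLetter e)⁻¹ *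
        (𝒢.preVertexHom (Γ.src e) (𝒢.srcHom e c))⁻¹} ∪
  {r | ∃ e ∈ S, r = 𝒢.preLetter e}

/-- The fundamental group of the graph of groups with respect to the spanning tree `S`. -/
abbrev FundamentalGroup : Type _ := 𝒢.PreGroup ⧸ Subgroup.normalClosure (𝒢.relators S)

/-- The canonical homomorphism of a vertex group to the fundamental group. -/
def vertexHom (v : V) : 𝒢.vertexGroup v →* 𝒢.FundamentalGroup S :=
  (QuotientGroup.mk' _).comp (𝒢.preVertexHom v)

/-- The stable letter of the edge `e` in the fundamental group. -/
def letter (e : E) : 𝒢.FundamentalGroup S := QuotientGroup.mk' _ (𝒢.preLetter e)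

/-- The vertex group `G_v` as a subgroup of the fundamental group `G`. -/
def vertexSubgroup (v : V) : Subgroup (𝒢.FundamentalGroup S) := (𝒢.vertexHom S v).range

/-- The edge group `G_e` as a subgroup of the fundamental group `G`, embedded through the vertex
group of the initial vertex of `e`. -/
def edgeSubgroup (e : E) : Subgroup (𝒢.FundamentalGroup S) :=
  ((𝒢.vertexHom S (Γ.src e)).comp (𝒢.srcHom e)).range

theorem edgeSubgroup_le_src (e : E) : 𝒢.edgeSubgroup S e ≤ 𝒢.vertexSubgroup S (Γ.src e) := by
  rintro _ ⟨c, rfl⟩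
  exact ⟨𝒢.srcHom e c, rfl⟩

theorem letter_conj (e : E) (c : 𝒢.edgeGroup e) :
    𝒢.letter S e * 𝒢.vertexHom S (Γ.tgt e) (𝒢.tgtHom e c) * (𝒢.letter S e)⁻¹ =
      𝒢.vertexHom S (Γ.src e) (𝒢.srcHom e c) := by
  have h : (QuotientGroup.mk' (Subgroup.normalClosure (𝒢.relators S)))
      (𝒢.preLetter e * 𝒢.preVertexHom (Γ.tgt e) (𝒢.tgtHom e c) * (𝒢.preLetter e)⁻¹ *
        (𝒢.preVertexHom (Γ.src e) (𝒢.srcHom e c))⁻¹) = 1 := by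
    rw [QuotientGroup.mk'_apply, QuotientGroup.eq_one_iff]
    exact Subgroup.subset_normalClosure (Or.inl ⟨e, c, rfl⟩)
  rw [map_mul, map_mul, map_mul, map_inv, map_inv, mul_inv_eq_one] at h
  exact h

/-- The vertices of the Bass–Serre tree: the cosets `g G_v` for `v` a vertex of `Γ`. The group `G`
acts on them by left multiplication. -/
abbrev TreeVertex : Type _ := Σ v : V, 𝒢.FundamentalGroup S ⧸ 𝒢.vertexSubgroup S v

/-- The edges of the Bass–Serre tree: the cosets `g G_e` for `e` an edge of `Γ`. The group `G`
acts on them by left multiplication. -/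
abbrev TreeEdge : Type _ := Σ e : E, 𝒢.FundamentalGroup S ⧸ 𝒢.edgeSubgroup S e

/-- The map `g G_e ↦ g t_e G_w`, where `w` is the terminal vertex of `e`. -/
def cosetTgt (e : E) : 𝒢.FundamentalGroup S ⧸ 𝒢.edgeSubgroup S e →
    𝒢.FundamentalGroup S ⧸ 𝒢.vertexSubgroup S (Γ.tgt e) :=
  Quotient.map' (fun g => g * 𝒢.letter S e) (by
    intro a b h
    rw [QuotientGroup.leftRel_apply] at h ⊢
    obtain ⟨c, hc⟩ := h
    refine ⟨𝒢.tgtHom e c, ?_⟩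
    have h2 := 𝒢.letter_conj S e c
    have h3 : 𝒢.vertexHom S (Γ.src e) (𝒢.srcHom e c) = a⁻¹ * b := hc
    rw [h3] at h2
    calc 𝒢.vertexHom S (Γ.tgt e) (𝒢.tgtHom e c)
        = (𝒢.letter S e)⁻¹ * (𝒢.letter S e * 𝒢.vertexHom S (Γ.tgt e) (𝒢.tgtHom e c) *
            (𝒢.letter S e)⁻¹) * 𝒢.letter S e := by group
      _ = (a * 𝒢.letter S e)⁻¹ * (b * 𝒢.letter S e) := by rw [h2]; group)

/-- The Bass–Serre tree of the graph of groups: for an edge `e` of `Γ` from `v` to `w`, the edge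
`g G_e` goes from `g G_v` to `g t_e G_w`. -/
def bassSerreTree : OrientedGraph (𝒢.TreeVertex S) (𝒢.TreeEdge S) where
  src ε := ⟨Γ.src ε.1, Subgroup.quotientMapOfLE (𝒢.edgeSubgroup_le_src S ε.1) ε.2⟩
  tgt ε := ⟨Γ.tgt ε.1, 𝒢.cosetTgt S ε.1 ε.2⟩

/-- The pointwise stabilizer `Stab(ρ)` of a path `ρ` in the Bass–Serre tree: the intersection of the
stabilizers of its edges. -/
def pathStab (l : List (𝒢.TreeEdge S × Bool)) : Subgroup (𝒢.FundamentalGroup S) :=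
  ⨅ d ∈ l, MulAction.stabilizer (𝒢.FundamentalGroup S) d.1

/-- The subgroups `G_ṽ ∩ Stab(ρ)` of the vertex stabilizers `G_ṽ`, for `ρ` a finite path in the
Bass–Serre tree through the vertex `ṽ`. Such a subgroup is recorded together with the vertex `ṽ` in
whose stabilizer it is considered. -/
def pathStabilizers : Set (𝒢.TreeVertex S × Subgroup (𝒢.FundamentalGroup S)) :=
  {p | ∃ x l y, (𝒢.bassSerreTree S).IsPath x l y ∧ p.1 ∈ (𝒢.bassSerreTree S).support x l ∧
    p.2 = MulAction.stabilizer (𝒢.FundamentalGroup S) p.1 ⊓ 𝒢.pathStab S l}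

/-- The `G`-conjugacy class of a subgroup `K` considered inside the stabilizer of the vertex `ṽ`:
all `(g • ṽ, g K g⁻¹)` with `g` in `G`. -/
def conjClass (p : 𝒢.TreeVertex S × Subgroup (𝒢.FundamentalGroup S)) :
    Set (𝒢.TreeVertex S × Subgroup (𝒢.FundamentalGroup S)) :=
  {q | ∃ g : 𝒢.FundamentalGroup S, q = (g • p.1, p.2.map (MulAut.conj g).toMonoidHom)}

end GraphOfGroups

/-- The `H`-conjugacy class `{h K h⁻¹ | h ∈ H}` of a subgroup `K` of `G`. -/
def subgroupConjClass {G : Type*} [Group G] (H K : Subgroup G) : Set (Subgroup G) :=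
  {L | ∃ h ∈ H, L = K.map (MulAut.conj h).toMonoidHom}

/-- `(G, Ω)` has finite stature: for each `H` in the collection `Ω` there are only finitely many
`H`-conjugacy classes of infinite subgroups of the form `H ∩ C`, where `C` is an intersection of
(possibly infinitely many) `G`-conjugates of members of `Ω`. -/
def FiniteStature {G : Type*} [Group G] {Λ : Type*} (Ω : Λ → Subgroup G) : Prop :=
  ∀ i : Λ, (subgroupConjClass (Ω i) '' {K : Subgroup G | Infinite K ∧
    ∃ 𝒞 : Set (Subgroup G),
      (∀ L ∈ 𝒞, ∃ (j : Λ) (g : G), L = (Ω j).map (MulAut.conj g).toMonoidHom) ∧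
      K = Ω i ⊓ sInf 𝒞}).Finite

end

/-! ### Suffix cosets (the core of a Schreier graph) and Howson's theorem. -/

namespace FreeGroup

variable {α : Type*}

/-! In the Bass–Serre tree an element fixing two vertices fixes the geodesic between them, and an
edge stabilizer is the intersection of the stabilizers of its ends. So every path stabilizer at a
vertex is an intersection of conjugates of vertex groups, and every `G_v ∩ gG_ug⁻¹` is a path
stabilizer. Finite stature therefore bounds the infinite path stabilizers up to conjugacy; the
finite ones are trivial, since free groups are torsion-free.

Conversely, suppose there are finitely many classes of path stabilizers. Howson's theorem, applied
edge by edge along a path, makes each of them finitely generated. A group `G_v ∩ C` is then an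
intersection of `G_v`-conjugates of finitely many finitely generated subgroups `H_i` of the free
group `G_v`, and it remains to see that only finitely many such intersections are nontrivial up to
conjugacy (`FreeGroup.exists_finite_conj_fixingSubgroup`). Such an intersection is the pointwise
stabilizer of a set of cosets of the `H_i`. If it contains `w ≠ 1`, conjugate so that `w` is
cyclically reduced: every coset it fixes then lies in the finite core of a Schreier graph, which has
only finitely many subsets.

The tree facts needed are that vertex groups embed, that the tree is connected, and that it has no
cycles. The last is encoded by an equivariant primitive of the boundary map
(`GraphOfGroups.exists_isPrimitive`). -/

theorem suffix_append_cases {β : Type*} {q L₁ L₂ : List β} (h : q <:+ L₁ ++ L₂) :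
    q <:+ L₂ ∨ ∃ q', q' <:+ L₁ ∧ q = q' ++ L₂ := by
  obtain ⟨p, hp⟩ := h
  rcases List.append_eq_append_iff.1 hp with ⟨a, h1, h2⟩ | ⟨a, h1, h2⟩
  · exact Or.inr ⟨a, ⟨p, h1.symm⟩, h2⟩
  · exact Or.inl ⟨a, h2.symm⟩

theorem Red.Step.exists_suffix_mk_eq {L₁ L₂ : List (α × Bool)} (h : Red.Step L₁ L₂) :
    ∀ q, q <:+ L₂ → ∃ q', q' <:+ L₁ ∧ mk q' = mk q := by
  intro q hq
  cases h with
  | @not A B x b =>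
    rcases suffix_append_cases hq with hq | ⟨a, ha, rfl⟩
    · exact ⟨q, hq.trans ⟨A ++ [(x, b), (x, !b)], by simp⟩, rfl⟩
    · obtain ⟨p, rfl⟩ := ha
      exact ⟨a ++ (x, b) :: (x, !b) :: B, ⟨p, by simp⟩, Quot.sound Red.Step.not⟩

/-- Reducing a word does not create new group elements among its suffixes. -/
theorem Red.exists_suffix_mk_eq {L₁ L₂ : List (α × Bool)} (h : Red L₁ L₂) :
    ∀ q, q <:+ L₂ → ∃ q', q' <:+ L₁ ∧ mk q' = mk q := by
  induction h with
  | refl => exact fun q hq => ⟨q, hq, rfl⟩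
  | tail _ hs ih =>
    intro q hq
    obtain ⟨q', hq', he⟩ := Red.Step.exists_suffix_mk_eq hs q hq
    obtain ⟨q'', h1, h2⟩ := ih q' hq'
    exact ⟨q'', h1, h2.trans he⟩

section

variable [DecidableEq α]

/-- The cosets `q K` where `q` runs over the suffixes of the reduced words of elements of `K`. -/
def suffixCosets (K : Subgroup (FreeGroup α)) : Set (FreeGroup α ⧸ K) :=
  {x | ∃ w ∈ K, ∃ q, q <:+ toWord w ∧ x = ((mk q : FreeGroup α) : FreeGroup α ⧸ K)}

/-- Read from right to left, a word in the generators of `K` is a concatenation of loops at the base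
coset, so it visits only the cosets on finitely many generator loops. Passing to the reduced word
visits no new coset. -/
theorem finite_suffixCosets_of_fg {K : Subgroup (FreeGroup α)} (hK : K.FG) :
    (suffixCosets K).Finite := by
  obtain ⟨T, hT⟩ := hK
  let Y : Set (FreeGroup α ⧸ K) := {((1 : FreeGroup α) : FreeGroup α ⧸ K)} ∪
    ⋃ t ∈ T, (fun q : List (α × Bool) => ((mk q : FreeGroup α) : FreeGroup α ⧸ K)) ''
      {q | q <:+ toWord t}
  have hY : Y.Finite := by
    refine (Set.finite_singleton _).union (Set.Finite.biUnion T.finite_toSet fun t _ => ?_)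
    refine Set.Finite.image _ ?_
    refine Set.Finite.subset (List.finite_toSet (toWord t).tails) fun q hq => ?_
    simpa using hq
  refine hY.subset ?_
  -- The spelling `L` need not be reduced, so it can be built by concatenation and inversion.
  have key : ∀ w ∈ Subgroup.closure (T : Set (FreeGroup α)), w ∈ K ∧ ∃ L, mk L = w ∧
      ∀ q, q <:+ L → ((mk q : FreeGroup α) : FreeGroup α ⧸ K) ∈ Y := by
    intro w hw
    induction hw using Subgroup.closure_induction with
    | mem t ht =>
      refine ⟨hT ▸ Subgroup.subset_closure ht, toWord t, mk_toWord, fun q hq => Or.inr ?_⟩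
      exact Set.mem_biUnion ht ⟨q, hq, rfl⟩
    | one =>
      refine ⟨K.one_mem, [], rfl, fun q hq => Or.inl ?_⟩
      rw [List.suffix_nil.1 hq]
      rfl
    | mul a b _ _ ha hb =>
      obtain ⟨haK, A, rfl, hA⟩ := ha
      obtain ⟨hbK, B, rfl, hB⟩ := hb
      refine ⟨K.mul_mem haK hbK, A ++ B, (mul_mk).symm, fun q hq => ?_⟩
      rcases suffix_append_cases hq with hq | ⟨q', hq', rfl⟩
      · exact hB q hq
      · have : ((mk (q' ++ B) : FreeGroup α) : FreeGroup α ⧸ K) = (mk q' : FreeGroup α) := by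
          rw [← mul_mk]
          exact QuotientGroup.mk_mul_of_mem _ hbK
        rw [this]
        exact hA q' hq'
    | inv a _ ha =>
      obtain ⟨haK, A, rfl, hA⟩ := ha
      refine ⟨K.inv_mem haK, invRev A, inv_mk.symm, fun q hq => ?_⟩
      obtain ⟨p, hp⟩ := hq
      have h1 : invRev p <:+ A := by
        refine ⟨invRev q, ?_⟩
        rw [← invRev_append, hp, invRev_invRev]
      -- Reversing a loop visits the same cosets: a suffix of the inverse word differs from a suffix
      -- of `A` by an element of `K` on the right.
      have h2 : (mk q : FreeGroup α) = mk (invRev p) * (mk A)⁻¹ := by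
        rw [inv_mk, ← hp, ← mul_mk, ← inv_mk]
        group
      rw [h2, QuotientGroup.mk_mul_of_mem _ (K.inv_mem haK)]
      exact hA _ h1
  rintro _ ⟨w, hw, q, hq, rfl⟩
  obtain ⟨-, L, rfl, hL⟩ := key w (hT ▸ hw)
  rw [toWord_mk] at hq
  obtain ⟨q', h1, h2⟩ := Red.exists_suffix_mk_eq reduce.red q hq
  rw [← h2]
  exact hL q' h1

/-- The core for the intersection embeds in the product of the two cores. -/
theorem finite_suffixCosets_inf {H K : Subgroup (FreeGroup α)} (hH : (suffixCosets H).Finite)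
    (hK : (suffixCosets K).Finite) : (suffixCosets (H ⊓ K)).Finite := by
  let f : FreeGroup α ⧸ (H ⊓ K) → (FreeGroup α ⧸ H) × (FreeGroup α ⧸ K) := fun x =>
    (Subgroup.quotientMapOfLE inf_le_left x, Subgroup.quotientMapOfLE inf_le_right x)
  have hf : Function.Injective f := by
    rintro ⟨a⟩ ⟨b⟩ h
    have h1 : (a : FreeGroup α ⧸ H) = b := congrArg Prod.fst h
    have h2 : (a : FreeGroup α ⧸ K) = b := congrArg Prod.snd h
    exact QuotientGroup.eq.2 ⟨QuotientGroup.eq.1 h1, QuotientGroup.eq.1 h2⟩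
  refine Set.Finite.of_finite_image ((hH.prod hK).subset ?_) hf.injOn
  rintro _ ⟨_, ⟨w, hw, q, hq, rfl⟩, rfl⟩
  exact ⟨⟨w, hw.1, q, hq, rfl⟩, ⟨w, hw.2, q, hq, rfl⟩⟩

/-- Schreier's argument: following the reduced word of an element of `K` suffix by suffix writes it
as a product of Schreier generators `x⁻¹ s y`, with `s` a letter and `x`, `y` representatives of
visited cosets. -/
theorem fg_of_finite_suffixCosets [Finite α] {K : Subgroup (FreeGroup α)}
    (hK : (suffixCosets K).Finite) : K.FG := by
  let A : Set (FreeGroup α) := Quotient.out '' suffixCosets K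
  let B : Set (FreeGroup α) := Set.range fun s : α × Bool => (mk [s] : FreeGroup α)
  have hA : A.Finite := hK.image _
  have hB : B.Finite := Set.finite_range _
  -- The set `A` itself is included because the representative chosen for the trivial coset need not
  -- be `1`.
  let T : Set (FreeGroup α) :=
    (A ∪ Set.image2 (· * ·) (Set.image2 (fun x y => x⁻¹ * y) A B) A) ∩ K
  have hT : T.Finite :=
    (hA.union (((hA.image2 _ hB)).image2 _ hA)).inter_of_left _
  have hTK : Subgroup.closure T ≤ K := (Subgroup.closure_le _).2 Set.inter_subset_right
  suffices h : K ≤ Subgroup.closure T by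
    refine (Subgroup.fg_iff _).2 ⟨T, le_antisymm hTK h, hT⟩
  intro w hw
  have hout : ∀ g : FreeGroup α, ((g : FreeGroup α ⧸ K).out)⁻¹ * g ∈ K := fun g =>
    QuotientGroup.eq.1 (QuotientGroup.out_eq' _)
  have hmem : ∀ q, q <:+ toWord w → ((mk q : FreeGroup α) : FreeGroup α ⧸ K).out ∈ A :=
    fun q hq => ⟨_, ⟨w, hw, q, hq, rfl⟩, rfl⟩
  have h1K : ((1 : FreeGroup α) : FreeGroup α ⧸ K).out ∈ Subgroup.closure T := by
    refine Subgroup.subset_closure ⟨Or.inl (hmem [] (List.nil_suffix)), ?_⟩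
    have := hout 1
    rw [mul_one] at this
    exact K.inv_mem_iff.1 this
  have key : ∀ q, q <:+ toWord w →
      (((mk q : FreeGroup α) : FreeGroup α ⧸ K).out)⁻¹ * mk q ∈ Subgroup.closure T := by
    intro q
    induction q with
    | nil =>
      intro _
      rw [← one_eq_mk, mul_one]
      exact Subgroup.inv_mem _ h1K
    | cons s q ih =>
      intro hq
      have hq' : q <:+ toWord w := (List.suffix_cons s q).trans hq
      have hm : (mk (s :: q) : FreeGroup α) = mk [s] * mk q := by rw [mul_mk]; rfl
      set a := ((mk (s :: q) : FreeGroup α) : FreeGroup α ⧸ K).out with ha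
      set b := ((mk q : FreeGroup α) : FreeGroup α ⧸ K).out with hb
      have hab : a⁻¹ * mk (s :: q) = (a⁻¹ * mk [s] * b) * (b⁻¹ * mk q) := by
        rw [hm]; group
      rw [hab]
      refine Subgroup.mul_mem _ (Subgroup.subset_closure ⟨Or.inr ?_, ?_⟩) (ih hq')
      · exact ⟨_, ⟨a, hmem _ hq, _, ⟨s, rfl⟩, rfl⟩, b, hmem _ hq', rfl⟩
      · have h1 := hout (mk (s :: q))
        have h2 := hout (mk q)
        rw [← ha, hab] at h1
        exact (K.mul_mem_cancel_right h2).1 h1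
  have hk := key _ (List.suffix_refl _)
  rw [mk_toWord] at hk
  have hw1 : (w : FreeGroup α ⧸ K) = (1 : FreeGroup α) :=
    QuotientGroup.eq.2 (by simpa using hw)
  rw [hw1] at hk
  simpa using Subgroup.mul_mem _ h1K hk

end

/-- **Howson's theorem**: the intersection of two finitely generated subgroups of a free group of
finite rank is finitely generated. -/
theorem fg_inf [Finite α] {H K : Subgroup (FreeGroup α)} (hH : H.FG) (hK : K.FG) :
    (H ⊓ K).FG := by
  classical
  exact fg_of_finite_suffixCosets
    (finite_suffixCosets_inf (finite_suffixCosets_of_fg hH) (finite_suffixCosets_of_fg hK))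

/-- The abelianization is a finitely generated `ℤ`-module with basis indexed by `α`. -/
theorem finite_of_fg (h : Group.FG (FreeGroup α)) : Finite α := by
  have h1 : Group.FG (Abelianization (FreeGroup α)) :=
    Group.fg_of_surjective (f := Abelianization.of) QuotientGroup.mk_surjective
  have h2 : AddGroup.FG (FreeAbelianGroup α) := AddGroup.fg_iff_mul_fg.2 h1
  have h3 : Module.Finite ℤ (FreeAbelianGroup α) := Module.Finite.iff_addGroup_fg.2 h2
  exact Module.Finite.finite_basis (FreeAbelianGroup.basis α)

/-! ### Cyclically reduced words and intersections of conjugates. -/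

section

variable [DecidableEq α]

theorem toWord_mk_singleton_mul (s : α × Bool) (g : FreeGroup α) :
    toWord (mk [s] * g) = s :: toWord g ∨
      toWord g = (s.1, !s.2) :: toWord (mk [s] * g) := by
  have h : toWord (mk [s] * g) = reduce (s :: toWord g) := by
    conv_lhs => rw [← mk_toWord (x := g), mul_mk, toWord_mk]
    rfl
  rw [h, reduce.cons, reduce_toWord]
  rcases toWord g with _ | ⟨b, L⟩
  · exact Or.inl rfl
  · by_cases hb : s.1 = b.1 ∧ s.2 = !b.2
    · right
      simp only [hb, and_self, if_true]
      simp
    · left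
      simp only [hb, if_false]

/-- Multiplying by a nonempty reduced word on the left either leaves its first letter in place or
cancels the whole word. -/
theorem toWord_mk_cons_mul (g : FreeGroup α) : ∀ (W : List (α × Bool)) (a : α × Bool),
    IsReduced (a :: W) → (∃ r, toWord (mk (a :: W) * g) = a :: r) ∨
      toWord g = invRev (a :: W) ++ toWord (mk (a :: W) * g)
  | [], a, _ => by
    rcases toWord_mk_singleton_mul a g with h | h
    · exact Or.inl ⟨_, h⟩
    · exact Or.inr h
  | b :: W, a, hr => by
    have hm : mk (a :: b :: W) * g = mk [a] * (mk (b :: W) * g) := by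
      rw [← mul_assoc, mul_mk]; rfl
    have hr' := isReduced_cons_cons.1 hr
    rcases toWord_mk_singleton_mul a (mk (b :: W) * g) with h | h
    · exact Or.inl ⟨_, hm ▸ h⟩
    · right
      rcases toWord_mk_cons_mul g W b hr'.2 with ⟨r, h'⟩ | h'
      · rw [h'] at h
        have hb := (List.cons_eq_cons.1 h).1
        have := hr'.1 (by rw [hb])
        rw [hb] at this
        simp at this
      · rw [h', h, hm]
        simp [invRev]

/-- As long as the whole factor cancels, the word of `g` gets strictly shorter, so after finitely
many multiplications the first letter survives. -/
theorem exists_toWord_pow_mul {a : α × Bool} {W : List (α × Bool)} (hr : IsReduced (a :: W)) :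
    ∀ (n : ℕ) (g : FreeGroup α), (toWord g).length ≤ n →
      ∃ (j : ℕ) (r : List (α × Bool)), toWord (mk (a :: W) ^ j * g) = a :: r
  | 0, g, hg => by
    refine ⟨1, W, ?_⟩
    have : g = 1 := toWord_eq_nil_iff.1 (List.length_eq_zero_iff.1 (Nat.le_zero.1 hg))
    rw [this, pow_one, mul_one, toWord_mk, hr.reduce_eq]
  | n + 1, g, hg => by
    rcases toWord_mk_cons_mul g W a hr with ⟨r, h⟩ | h
    · exact ⟨1, r, by rw [pow_one, h]⟩
    · have hl := congrArg List.length h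
      rw [List.length_append, invRev_length, List.length_cons] at hl
      obtain ⟨j, r, hj⟩ := exists_toWord_pow_mul hr n (mk (a :: W) * g) (by omega)
      exact ⟨j + 1, r, by rw [pow_succ, mul_assoc, hj]⟩

/-- A coset fixed by a nontrivial cyclically reduced element is visited by a reduced word. -/
theorem mem_suffixCosets_of_smul_eq {K : Subgroup (FreeGroup α)} {L : List (α × Bool)}
    (hL : IsCyclicallyReduced L) (hne : L ≠ []) {x : FreeGroup α ⧸ K}
    (hx : (mk L : FreeGroup α) • x = x) : x ∈ suffixCosets K := by
  obtain ⟨g, rfl⟩ := QuotientGroup.mk_surjective x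
  set w : FreeGroup α := mk L with hw
  have hst : w ∈ MulAction.stabilizer (FreeGroup α) (g : FreeGroup α ⧸ K) := hx
  obtain ⟨a, W, hLa⟩ := List.exists_cons_of_ne_nil hne
  have hLz : L = L.dropLast ++ [L.getLast hne] := (List.dropLast_append_getLast hne).symm
  set z := L.getLast hne with hz
  have hinv : invRev L = (z.1, !z.2) :: invRev L.dropLast := by
    conv_lhs => rw [hLz]
    simp [invRev]
  have hred : IsReduced (invRev L) := by
    rw [isReduced_iff_reduce_eq, reduce_invRev, hL.isReduced.reduce_eq]
  obtain ⟨j, r, hj⟩ := exists_toWord_pow_mul (hLa ▸ hL.isReduced) _ g le_rfl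
  obtain ⟨i, s, hi⟩ := exists_toWord_pow_mul (hinv ▸ hred) _ g le_rfl
  rw [← hLa, ← hw] at hj
  rw [← hinv, ← inv_mk, ← hw] at hi
  -- The word of `p` ends in the last letter of `L` and that of `w ^ j * g` begins with its first
  -- letter. Cyclic reducedness makes their concatenation a reduced word; it spells `g⁻¹ * w ^ (i +
  -- j) * g`, an element of `K`, and its suffix `w ^ j * g` represents the coset of `g`.
  set p : FreeGroup α := (w⁻¹ ^ i * g)⁻¹ with hp
  have hpw : toWord p = invRev s ++ [z] := by
    rw [hp, toWord_inv, hi]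
    simp [invRev]
  have hred2 : IsReduced (toWord p ++ toWord (w ^ j * g)) := by
    refine List.IsChain.append isReduced_toWord isReduced_toWord ?_
    intro x hx y hy
    rw [hpw] at hx
    rw [hj] at hy
    simp only [List.getLast?_append, List.getLast?_singleton, Option.some_or, Option.mem_def,
      Option.some.injEq, List.head?_cons] at hx hy
    subst hx hy
    refine hL.2 _ ?_ _ ?_
    · rw [List.getLast?_eq_getLast_of_ne_nil hne]; rfl
    · rw [hLa]; rfl
  refine ⟨p * (w ^ j * g), ?_, toWord (w ^ j * g), ?_, ?_⟩
  · have h1 : w ^ (i + j) ∈ MulAction.stabilizer (FreeGroup α) (g : FreeGroup α ⧸ K) :=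
      Subgroup.pow_mem _ hst _
    have h2 : ((w ^ (i + j) * g : FreeGroup α) : FreeGroup α ⧸ K) = g := h1
    have h3 := QuotientGroup.eq.1 h2.symm
    have h4 : p * (w ^ j * g) = g⁻¹ * (w ^ (i + j) * g) := by
      rw [hp, pow_add]; group
    rw [h4]
    exact h3
  · rw [toWord_mul p, hred2.reduce_eq]
    exact List.suffix_append _ _
  · rw [mk_toWord]
    have h1 : w ^ j ∈ MulAction.stabilizer (FreeGroup α) (g : FreeGroup α ⧸ K) :=
      Subgroup.pow_mem _ hst _
    exact (show ((w ^ j * g : FreeGroup α) : FreeGroup α ⧸ K) = g from h1).symm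

end

/-- Up to conjugacy there are only finitely many nontrivial intersections of conjugates of
finitely many given finitely generated subgroups of a free group. -/
theorem exists_finite_conj_fixingSubgroup {ι : Type*} [Finite ι]
    (H : ι → Subgroup (FreeGroup α)) (hH : ∀ i, (H i).FG) :
    ∃ 𝒦 : Set (Subgroup (FreeGroup α)), 𝒦.Finite ∧ ∀ A : Set (Σ i, FreeGroup α ⧸ H i),
      fixingSubgroup (FreeGroup α) A ≠ ⊥ →
        ∃ c : FreeGroup α, (fixingSubgroup (FreeGroup α) A).map (MulAut.conj c).toMonoidHom ∈ 𝒦 := by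
  classical
  let Y : Set (Σ i, FreeGroup α ⧸ H i) := ⋃ i, Sigma.mk i '' suffixCosets (H i)
  have hY : Y.Finite :=
    Set.finite_iUnion fun i => (finite_suffixCosets_of_fg (hH i)).image _
  refine ⟨(fun B : Set (Σ i, FreeGroup α ⧸ H i) => fixingSubgroup (FreeGroup α) B) '' 𝒫 Y,
    hY.finite_subsets.image _, fun A hA => ?_⟩
  obtain ⟨w, hwA, hw1⟩ : ∃ w ∈ fixingSubgroup (FreeGroup α) A, w ≠ 1 := by
    by_contra! h
    exact hA ((Subgroup.eq_bot_iff_forall _).2 h)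
  set L := toWord w with hL
  set c : FreeGroup α := (mk (reduceCyclically.conjugator L))⁻¹ with hc
  have hconj : c * w * c⁻¹ = mk (reduceCyclically L) := by
    have h := congrArg (mk (α := α)) (reduceCyclically.conj_conjugator_reduceCyclically L)
    rw [← mul_mk, ← mul_mk, ← inv_mk, show mk L = w from mk_toWord] at h
    rw [hc, ← h]
    group
  have hne : reduceCyclically L ≠ [] := by
    intro h
    rw [h, ← one_eq_mk, mul_inv_eq_one, mul_eq_left] at hconj
    exact hw1 hconj
  -- Conjugating by `c` translates the fixed set; all of the translate is fixed by the cyclically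
  -- reduced `c * w * c⁻¹`, hence lies in `Y`.
  refine ⟨c, (fun x => c • x) '' A, ?_, ?_⟩
  · rintro _ ⟨⟨i, x⟩, hx, rfl⟩
    refine Set.mem_iUnion.2 ⟨i, c • x, ?_, rfl⟩
    refine mem_suffixCosets_of_smul_eq (reduceCyclically.isCyclicallyReduced isReduced_toWord)
      hne ?_
    have hx' : w • x = x :=
      eq_of_heq (Sigma.mk.inj ((mem_fixingSubgroup_iff _).1 hwA _ hx)).2
    rw [← hconj, mul_smul, mul_smul, inv_smul_smul, hx']
  · ext g
    rw [mem_fixingSubgroup_iff, Subgroup.mem_map_equiv, mem_fixingSubgroup_iff,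
      Set.forall_mem_image]
    refine forall₂_congr fun x _ => ?_
    rw [MulAut.conj_symm_apply, mul_smul, mul_smul, inv_smul_eq_iff]

end FreeGroup

/-! ### Walks, potentials on spanning trees, geodesics, and primitives of the boundary map. -/

namespace OrientedGraph

variable {V E : Type*} {Γ : OrientedGraph V E}

theorem isWalk_append {l₁ l₂ : List (E × Bool)} {x y : V} :
    Γ.IsWalk x (l₁ ++ l₂) y ↔ ∃ z, Γ.IsWalk x l₁ z ∧ Γ.IsWalk z l₂ y := by
  induction l₁ generalizing x with
  | nil => simp [IsWalk]
  | cons d l ih => simp [IsWalk, ih, and_assoc]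

theorem isWalk_singleton {d : E × Bool} {x y : V} :
    Γ.IsWalk x [d] y ↔ Γ.dartStart d = x ∧ Γ.dartEnd d = y := Iff.rfl

theorem exists_isWalk_symm {l : List (E × Bool)} {x y : V} (h : Γ.IsWalk x l y) :
    ∃ l', Γ.IsWalk y l' x := by
  induction l generalizing x with
  | nil => exact ⟨[], Eq.symm h⟩
  | cons d l ih =>
    obtain ⟨l', hl'⟩ := ih h.2
    refine ⟨l' ++ [(d.1, !d.2)], isWalk_append.2 ⟨_, hl', ?_⟩⟩
    obtain ⟨e, b⟩ := d
    rw [isWalk_singleton, ← h.1]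
    cases b <;> simp [dartStart, dartEnd]

theorem dartStart_eq_or_of_fst_eq {d d' : E × Bool} (h : d.1 = d'.1) :
    Γ.dartStart d = Γ.dartStart d' ∨ Γ.dartStart d = Γ.dartEnd d' := by
  obtain ⟨e, b⟩ := d
  obtain ⟨e', b'⟩ := d'
  obtain rfl : e = e' := h
  cases b <;> cases b' <;> simp [dartStart, dartEnd]

/-- A labelling of the edges by elements of a group is, on a spanning tree, the coboundary of a
labelling of the vertices. -/
theorem IsSpanningTree.exists_potential {S : Set E} (hS : Γ.IsSpanningTree S) {Q : Type*}
    [Group Q] (τ : E → Q) : ∃ σ : V → Q, ∀ e ∈ S, σ (Γ.tgt e) = σ (Γ.src e) * τ e := by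
  obtain ⟨⟨r⟩, hS⟩ := hS
  choose l hl hu using hS r
  let ev : List (E × Bool) → Q := fun l =>
    (l.map fun d => if d.2 then τ d.1 else (τ d.1)⁻¹).prod
  refine ⟨fun v => ev (l v), fun e he => ?_⟩
  obtain ⟨⟨hw, hc⟩, hm⟩ := hl (Γ.src e)
  -- By uniqueness, the tree path to `tgt e` either drops a final reversed `e` from the path to `src
  -- e` or appends `e` to it.
  by_cases hd : ∃ L, l (Γ.src e) = L ++ [(e, false)]
  · obtain ⟨L, hL⟩ := hd
    rw [hL] at hw hc hm
    obtain ⟨z, hz, hz'⟩ := isWalk_append.1 hw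
    have hzt : Γ.tgt e = z := (isWalk_singleton.1 hz').1
    have h1 : L = l (Γ.tgt e) := hu _ _ ⟨⟨hzt ▸ hz, hc.left_of_append⟩,
      fun d hd => hm d (List.mem_append_left _ hd)⟩
    simp only [← h1, hL, ev]
    simp
  · have h1 : l (Γ.src e) ++ [(e, true)] = l (Γ.tgt e) := by
      refine hu _ _ ⟨⟨isWalk_append.2 ⟨_, hw, rfl, rfl⟩, ?_⟩, ?_⟩
      · refine List.IsChain.append hc (List.isChain_singleton _) ?_
        rintro ⟨e', b⟩ ha _ hb h
        obtain rfl : (e, true) = _ := by simpa using hb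
        obtain rfl : e' = e := h
        cases b with
        | true => rfl
        | false =>
          obtain ⟨L, hL⟩ := List.getLast?_eq_some_iff.1 ha
          exact absurd ⟨L, hL⟩ hd
      · intro d hd
        rcases List.mem_append.1 hd with hd | hd
        · exact hm d hd
        · rw [List.mem_singleton.1 hd]
          exact he
    simp only [← h1, ev]
    simp

/-- A walk of minimal length between its end points. -/
def IsGeodesic (Γ : OrientedGraph V E) (x : V) (l : List (E × Bool)) (y : V) : Prop :=
  Γ.IsWalk x l y ∧ ∀ l', Γ.IsWalk x l' y → l.length ≤ l'.length

theorem exists_isGeodesic {x y : V} {l : List (E × Bool)} (h : Γ.IsWalk x l y) :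
    ∃ l', Γ.IsGeodesic x l' y := by
  classical
  have hex : ∃ n, ∃ l, Γ.IsWalk x l y ∧ l.length = n := ⟨_, l, h, rfl⟩
  obtain ⟨l', h1, h2⟩ := Nat.find_spec hex
  exact ⟨l', h1, fun l'' h'' => h2 ▸ Nat.find_min' hex ⟨l'', h'', rfl⟩⟩

theorem IsGeodesic.tail {x y : V} {d : E × Bool} {l : List (E × Bool)}
    (h : Γ.IsGeodesic x (d :: l) y) : Γ.IsGeodesic (Γ.dartEnd d) l y :=
  ⟨h.1.2, fun l' hl' => by simpa using h.2 (d :: l') ⟨h.1.1, hl'⟩⟩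

/-- A return to the starting vertex could be cut out, shortening the walk. -/
theorem IsGeodesic.ne_of_mem_tail {x y : V} {d d' : E × Bool} {l : List (E × Bool)}
    (h : Γ.IsGeodesic x (d :: l) y) (hd : d' ∈ l) : Γ.dartStart d' ≠ x ∧ Γ.dartEnd d' ≠ x := by
  obtain ⟨l₁, l₂, rfl⟩ := List.append_of_mem hd
  obtain ⟨z, -, hz, hw⟩ := isWalk_append.1 h.1.2
  constructor
  · intro hx
    have := h.2 (d' :: l₂) ⟨hx, hw⟩
    simp at this
    omega
  · intro hx
    have := h.2 l₂ (hx ▸ hw)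
    simp at this
    omega

theorem IsGeodesic.isPath {x y : V} {l : List (E × Bool)} (h : Γ.IsGeodesic x l y) :
    Γ.IsPath x l y := by
  refine ⟨h.1, ?_⟩
  induction l generalizing x with
  | nil => exact List.isChain_nil
  | cons d l ih =>
    refine List.isChain_cons.2 ⟨fun d' hd' he => ?_, ih h.tail⟩
    have hmem : d' ∈ l := List.mem_of_mem_head? hd'
    have hne := h.ne_of_mem_tail hmem
    rw [← h.1.1] at hne
    rcases dartStart_eq_or_of_fst_eq (Γ := Γ) he with h' | h'
    · exact absurd h'.symm hne.1
    · exact absurd h'.symm hne.2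

variable {G : Type*} [Group G] [MulAction G V] [MulAction G E]

/-- `f` is a primitive of the boundary map of the graph: crossing the edge `ε` adds `ε` to `f`. The
differences of `f` are equivariant. -/
structure IsPrimitive (Γ : OrientedGraph V E) (G : Type*) [Group G] [MulAction G V] [MulAction G E]
    (f : V → E →₀ ℤ) : Prop where
  tgt_eq : ∀ ε, f (Γ.tgt ε) = f (Γ.src ε) + Finsupp.single ε 1
  smul_sub : ∀ (g : G) (x y : V) (ε : E),
    (f (g • x) - f (g • y)) (g • ε) = (f x - f y) ε

namespace IsPrimitive

variable {f : V → E →₀ ℤ}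

/-- By equivariance the difference of `f` across `ε`, which is `ε` itself, has coefficient `1` at `g
• ε`. -/
theorem smul_edge_eq (hf : Γ.IsPrimitive G f) {g : G} {ε : E} (hs : g • Γ.src ε = Γ.src ε)
    (ht : g • Γ.tgt ε = Γ.tgt ε) : g • ε = ε := by
  have h := hf.smul_sub g (Γ.tgt ε) (Γ.src ε) ε
  rw [hs, ht, hf.tgt_eq, add_sub_cancel_left, Finsupp.single_eq_same] at h
  by_contra hne
  rw [Finsupp.single_eq_of_ne hne] at h
  exact zero_ne_one h

theorem eq_add_sum (hf : Γ.IsPrimitive G f) {l : List (E × Bool)} {x y : V}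
    (h : Γ.IsWalk x l y) :
    f y - f x = (l.map fun d => Finsupp.single d.1 (if d.2 then (1 : ℤ) else -1)).sum := by
  induction l generalizing x with
  | nil =>
    obtain rfl : x = y := h
    simp
  | cons d l ih =>
    have h1 : f (Γ.dartEnd d) - f x = Finsupp.single d.1 (if d.2 then (1 : ℤ) else -1) := by
      rw [← h.1]
      obtain ⟨e, b⟩ := d
      cases b <;> simp [dartStart, dartEnd, hf.tgt_eq]
    rw [List.map_cons, List.sum_cons, ← ih h.2, ← h1]
    abel

theorem sum_apply_eq_zero {l : List (E × Bool)} {ε : E} (h : ∀ d ∈ l, d.1 ≠ ε) :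
    (l.map fun d => Finsupp.single d.1 (if d.2 then (1 : ℤ) else -1)).sum ε = 0 := by
  induction l with
  | nil => simp
  | cons d l ih =>
    rw [List.map_cons, List.sum_cons, Finsupp.add_apply,
      ih fun d' hd' => h d' (List.mem_cons_of_mem _ hd'),
      Finsupp.single_eq_of_ne (h d List.mem_cons_self).symm, add_zero]

/-- A group element fixing both end points of a geodesic fixes all its edges. -/
theorem smul_eq_of_mem_geodesic (hf : Γ.IsPrimitive G f)
    (hsrc : ∀ (g : G) (ε : E), Γ.src (g • ε) = g • Γ.src ε)
    (htgt : ∀ (g : G) (ε : E), Γ.tgt (g • ε) = g • Γ.tgt ε)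
    {g : G} {l : List (E × Bool)} {x y : V} (h : Γ.IsGeodesic x l y) (hx : g • x = x)
    (hy : g • y = y) : ∀ d ∈ l, g • d.1 = d.1 := by
  induction l generalizing x with
  | nil => simp
  | cons d l ih =>
    have hstart : ∀ d : E × Bool, Γ.dartStart (g • d.1, d.2) = g • Γ.dartStart d := by
      rintro ⟨e, b⟩
      cases b <;> simp [dartStart, hsrc, htgt]
    have hend : ∀ d : E × Bool, Γ.dartEnd (g • d.1, d.2) = g • Γ.dartEnd d := by
      rintro ⟨e, b⟩
      cases b <;> simp [dartEnd, hsrc, htgt]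
    have hcoef : (f y - f x) d.1 ≠ 0 := by
      rw [hf.eq_add_sum h.1, List.map_cons, List.sum_cons, Finsupp.add_apply,
        sum_apply_eq_zero, Finsupp.single_eq_same]
      · split_ifs <;> simp
      · intro d' hd' he
        have hne := h.ne_of_mem_tail hd'
        rw [← h.1.1] at hne
        rcases dartStart_eq_or_of_fst_eq (Γ := Γ) he.symm with h' | h'
        · exact hne.1 h'.symm
        · exact hne.2 h'.symm
    -- The chain `f y - f x` is invariant under `g` and supported on the geodesic, so `g⁻¹ • d.1` is
    -- an edge of the geodesic. It touches `x`, and only the first edge does.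
    have hcoef' : (f y - f x) (g⁻¹ • d.1) ≠ 0 := by
      have := hf.smul_sub g y x (g⁻¹ • d.1)
      rw [hx, hy, smul_inv_smul] at this
      rwa [← this]
    obtain ⟨d', hd', he⟩ : ∃ d' ∈ d :: l, d'.1 = g⁻¹ • d.1 := by
      by_contra! hno
      rw [hf.eq_add_sum h.1, sum_apply_eq_zero hno] at hcoef'
      exact hcoef' rfl
    have hd : g • d.1 = d.1 := by
      rcases List.mem_cons.1 hd' with rfl | hmem
      · rw [eq_inv_smul_iff] at he
        exact he
      · exfalso
        have hne := h.ne_of_mem_tail hmem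
        have he' : d.1 = ((g • d'.1, d'.2) : E × Bool).1 := by rw [he, smul_inv_smul]
        rcases dartStart_eq_or_of_fst_eq (Γ := Γ) he' with h' | h'
        · rw [h.1.1, hstart] at h'
          exact hne.1 (smul_left_cancel g (hx.trans h')).symm
        · rw [h.1.1, hend] at h'
          exact hne.2 (smul_left_cancel g (hx.trans h')).symm
    have hx' : g • Γ.dartEnd d = Γ.dartEnd d := by
      rw [← hend, hd]
    intro d' hd'
    rcases List.mem_cons.1 hd' with rfl | hd'
    · exact hd
    · exact ih h.tail hx' d' hd'

end IsPrimitive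

end OrientedGraph

/-! ### The fundamental group and its Bass–Serre tree: embedding of vertex groups, acyclicity,
connectedness. -/

namespace GraphOfGroups

variable {V E : Type*} {Γ : OrientedGraph V E} (𝒢 : GraphOfGroups Γ) (S : Set E)

theorem letter_eq_one {e : E} (he : e ∈ S) : 𝒢.letter S e = 1 := by
  rw [letter, QuotientGroup.mk'_apply, QuotientGroup.eq_one_iff]
  exact Subgroup.subset_normalClosure (Or.inr ⟨e, he, rfl⟩)

/-- The universal property of the fundamental group. -/
theorem exists_hom {Q : Type*} [Group Q] (ρ : ∀ v, 𝒢.vertexGroup v →* Q) (τ : E → Q)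
    (hrel : ∀ e c, τ e * ρ _ (𝒢.tgtHom e c) = ρ _ (𝒢.srcHom e c) * τ e)
    (hS : ∀ e ∈ S, τ e = 1) :
    ∃ Ψ : 𝒢.FundamentalGroup S →* Q, (∀ v g, Ψ (𝒢.vertexHom S v g) = ρ v g) ∧
      ∀ e, Ψ (𝒢.letter S e) = τ e := by
  let ψ : 𝒢.PreGroup →* Q := Monoid.Coprod.lift (Monoid.CoprodI.lift ρ) (FreeGroup.lift τ)
  have hv : ∀ v g, ψ (𝒢.preVertexHom v g) = ρ v g := fun v g => by simp [ψ, preVertexHom]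
  have ht : ∀ e, ψ (𝒢.preLetter e) = τ e := fun e => by simp [ψ, preLetter]
  have hle : Subgroup.normalClosure (𝒢.relators S) ≤ ψ.ker := by
    refine Subgroup.normalClosure_le_normal ?_
    rintro r (⟨e, c, rfl⟩ | ⟨e, he, rfl⟩)
    · simp only [SetLike.mem_coe, MonoidHom.mem_ker, map_mul, map_inv, hv, ht, hrel,
        mul_inv_cancel_right, mul_inv_cancel]
    · simp only [SetLike.mem_coe, MonoidHom.mem_ker, ht, hS e he]
  exact ⟨QuotientGroup.lift _ ψ hle, hv, ht⟩

theorem eq_top_of_mem {H : Subgroup (𝒢.FundamentalGroup S)}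
    (hv : ∀ v g, 𝒢.vertexHom S v g ∈ H) (ht : ∀ e, 𝒢.letter S e ∈ H) : H = ⊤ := by
  refine (Subgroup.eq_top_iff' H).2 fun x => ?_
  obtain ⟨x, rfl⟩ := QuotientGroup.mk'_surjective _ x
  induction x using Monoid.Coprod.induction_on with
  | inl x =>
    induction x using Monoid.CoprodI.induction_on with
    | one => simp
    | of v g => exact hv v g
    | mul a b ha hb =>
      rw [map_mul, map_mul]
      exact H.mul_mem ha hb
  | inr x =>
    induction x using FreeGroup.induction_on with
    | C1 => simp
    | of e => exact ht e
    | inv_of e h =>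
      rw [map_inv, map_inv]
      exact H.inv_mem h
    | mul a b ha hb =>
      rw [map_mul, map_mul]
      exact H.mul_mem ha hb
  | mul a b ha hb =>
    rw [map_mul]
    exact H.mul_mem ha hb

/-- The vertex groups embed in the fundamental group. -/
theorem vertexHom_injective {S : Set E} (hS : Γ.IsSpanningTree S) (v : V) :
    Function.Injective (𝒢.vertexHom S v) := by
  classical
  let P := Monoid.CoprodI 𝒢.vertexGroup
  let a : ∀ e, 𝒢.edgeGroup e →* P := fun e => Monoid.CoprodI.of.comp (𝒢.tgtHom e)
  let b : ∀ e, 𝒢.edgeGroup e →* P := fun e => Monoid.CoprodI.of.comp (𝒢.srcHom e)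
  have ha : ∀ e, Function.Injective (a e) := fun e =>
    (Monoid.CoprodI.of_injective _).comp (𝒢.tgtHom_injective e)
  have hb : ∀ e, Function.Injective (b e) := fun e =>
    (Monoid.CoprodI.of_injective _).comp (𝒢.srcHom_injective e)
  let φ : ∀ e, (a e).range ≃* (b e).range := fun e =>
    (MonoidHom.ofInjective (ha e)).symm.trans (MonoidHom.ofInjective (hb e))
  let ι : ∀ e, P →* HNNExtension P (a e).range (b e).range (φ e) := fun e => HNNExtension.of
  have hι : ∀ e, Function.Injective (ι e) := fun e => HNNExtension.of_injective (φ e)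
  -- `Q` adjoins all stable letters to the free product of the vertex groups, by amalgamating one
  -- HNN extension per edge over that product. It does not kill the letters of the spanning tree;
  -- the potential `σ` corrects this by conjugating each vertex group so that those letters become
  -- trivial.
  let Q := Monoid.PushoutI ι
  let β : P →* Q := Monoid.PushoutI.base ι
  let τ : E → Q := fun e => Monoid.PushoutI.of e HNNExtension.t
  have hτ : ∀ e c, τ e * β (a e c) = β (b e c) * τ e := by
    intro e c
    have h := HNNExtension.t_mul_of (φ := φ e) (MonoidHom.ofInjective (ha e) c)
    have h1 : φ e (MonoidHom.ofInjective (ha e) c) = MonoidHom.ofInjective (hb e) c := by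
      simp [φ]
    rw [h1] at h
    have h2 := congrArg (Monoid.PushoutI.of (φ := ι) e) h
    rw [map_mul, map_mul] at h2
    simp only [τ, β]
    rw [← Monoid.PushoutI.of_apply_eq_base ι e, ← Monoid.PushoutI.of_apply_eq_base ι e]
    exact h2
  obtain ⟨σ, hσ⟩ := hS.exists_potential τ
  obtain ⟨Ψ, hΨ, -⟩ := 𝒢.exists_hom S
    (fun v => (MulAut.conj (σ v)).toMonoidHom.comp (β.comp Monoid.CoprodI.of))
    (fun e => σ (Γ.src e) * τ e * (σ (Γ.tgt e))⁻¹)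
    (by
      intro e c
      have h := hτ e c
      change σ (Γ.src e) * τ e * (σ (Γ.tgt e))⁻¹ *
        (σ (Γ.tgt e) * β (a e c) * (σ (Γ.tgt e))⁻¹) =
        (σ (Γ.src e) * β (b e c) * (σ (Γ.src e))⁻¹) * (σ (Γ.src e) * τ e * (σ (Γ.tgt e))⁻¹)
      calc _ = σ (Γ.src e) * (τ e * β (a e c)) * (σ (Γ.tgt e))⁻¹ := by group
        _ = _ := by rw [h]; group)
    (by
      intro e he
      rw [hσ e he, mul_inv_cancel])
  have hcomp : Function.Injective (fun g => Ψ (𝒢.vertexHom S v g)) := by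
    simp only [hΨ]
    exact (MulAut.conj (σ v)).injective.comp
      ((Monoid.PushoutI.base_injective hι).comp (Monoid.CoprodI.of_injective v))
  exact Function.Injective.of_comp hcomp

theorem bassSerreTree_src_smul (g : 𝒢.FundamentalGroup S) (ε : 𝒢.TreeEdge S) :
    (𝒢.bassSerreTree S).src (g • ε) = g • (𝒢.bassSerreTree S).src ε := by
  obtain ⟨e, ⟨x⟩⟩ := ε
  rfl

theorem bassSerreTree_tgt_smul (g : 𝒢.FundamentalGroup S) (ε : 𝒢.TreeEdge S) :
    (𝒢.bassSerreTree S).tgt (g • ε) = g • (𝒢.bassSerreTree S).tgt ε := by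
  obtain ⟨e, ⟨x⟩⟩ := ε
  change (⟨Γ.tgt e, ((g * x * 𝒢.letter S e : 𝒢.FundamentalGroup S) : _ ⧸ _)⟩ : 𝒢.TreeVertex S) =
    ⟨Γ.tgt e, ((g * (x * 𝒢.letter S e) : 𝒢.FundamentalGroup S) : _ ⧸ _)⟩
  rw [mul_assoc]

/-- The action of the fundamental group on the free abelian group on the edges of the tree. -/
noncomputable def edgePerm : 𝒢.FundamentalGroup S →* Equiv.Perm (𝒢.TreeEdge S →₀ ℤ) where
  toFun g := (Finsupp.domCongr (MulAction.toPerm g)).toEquiv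
  map_one' := by
    ext m ε
    simp [Finsupp.domCongr]
  map_mul' g h := by
    ext m ε
    simp [Finsupp.domCongr, mul_smul]

theorem edgePerm_add (g : 𝒢.FundamentalGroup S) (m n : 𝒢.TreeEdge S →₀ ℤ) :
    𝒢.edgePerm S g (m + n) = 𝒢.edgePerm S g m + 𝒢.edgePerm S g n :=
  map_add (Finsupp.domCongr (MulAction.toPerm g)) m n

theorem edgePerm_single (g : 𝒢.FundamentalGroup S) (ε : 𝒢.TreeEdge S) (n : ℤ) :
    𝒢.edgePerm S g (Finsupp.single ε n) = Finsupp.single (g • ε) n :=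
  Finsupp.equivMapDomain_single _ _ _

theorem edgePerm_apply_smul (g : 𝒢.FundamentalGroup S) (m : 𝒢.TreeEdge S →₀ ℤ)
    (ε : 𝒢.TreeEdge S) : 𝒢.edgePerm S g m (g • ε) = m ε := by
  change m (g⁻¹ • g • ε) = m ε
  rw [inv_smul_smul]

/-- The edge of the Bass–Serre tree given by the trivial coset. -/
def baseEdge (e : E) : 𝒢.TreeEdge S := ⟨e, ((1 : 𝒢.FundamentalGroup S) : _ ⧸ _)⟩

/-- The vertex of the Bass–Serre tree given by the trivial coset. -/
def baseVertex (v : V) : 𝒢.TreeVertex S := ⟨v, ((1 : 𝒢.FundamentalGroup S) : _ ⧸ _)⟩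

theorem exists_smul_baseEdge (ε : 𝒢.TreeEdge S) : ∃ (g : 𝒢.FundamentalGroup S) (e : E), ε = g • 𝒢.baseEdge S e := by
  obtain ⟨e, ⟨x⟩⟩ := ε
  refine ⟨x, e, ?_⟩
  change (⟨e, (x : _ ⧸ _)⟩ : 𝒢.TreeEdge S) =
    ⟨e, ((x * 1 : 𝒢.FundamentalGroup S) : _ ⧸ _)⟩
  rw [mul_one]

theorem exists_smul_baseVertex (x : 𝒢.TreeVertex S) : ∃ (g : 𝒢.FundamentalGroup S) (v : V), x = g • 𝒢.baseVertex S v := by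
  obtain ⟨v, ⟨x⟩⟩ := x
  refine ⟨x, v, ?_⟩
  change (⟨v, (x : _ ⧸ _)⟩ : 𝒢.TreeVertex S) =
    ⟨v, ((x * 1 : 𝒢.FundamentalGroup S) : _ ⧸ _)⟩
  rw [mul_one]

theorem smul_baseVertex_eq_iff {g : 𝒢.FundamentalGroup S} {v : V} :
    g • 𝒢.baseVertex S v = 𝒢.baseVertex S v ↔ g ∈ 𝒢.vertexSubgroup S v := by
  change (⟨v, ((g * 1 : 𝒢.FundamentalGroup S) : _ ⧸ _)⟩ : 𝒢.TreeVertex S) =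
    ⟨v, ((1 : 𝒢.FundamentalGroup S) : _ ⧸ _)⟩ ↔ _
  rw [mul_one, Sigma.mk.injEq, heq_eq_eq, eq_comm, QuotientGroup.eq]
  simp

theorem smul_baseEdge_eq_iff {g : 𝒢.FundamentalGroup S} {e : E} :
    g • 𝒢.baseEdge S e = 𝒢.baseEdge S e ↔ g ∈ 𝒢.edgeSubgroup S e := by
  change (⟨e, ((g * 1 : 𝒢.FundamentalGroup S) : _ ⧸ _)⟩ : 𝒢.TreeEdge S) =
    ⟨e, ((1 : 𝒢.FundamentalGroup S) : _ ⧸ _)⟩ ↔ _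
  rw [mul_one, Sigma.mk.injEq, heq_eq_eq, eq_comm, QuotientGroup.eq]
  simp

theorem stabilizer_baseVertex (v : V) :
    MulAction.stabilizer (𝒢.FundamentalGroup S) (𝒢.baseVertex S v) = 𝒢.vertexSubgroup S v :=
  Subgroup.ext fun _ => 𝒢.smul_baseVertex_eq_iff S

theorem stabilizer_baseEdge (e : E) :
    MulAction.stabilizer (𝒢.FundamentalGroup S) (𝒢.baseEdge S e) = 𝒢.edgeSubgroup S e :=
  Subgroup.ext fun _ => 𝒢.smul_baseEdge_eq_iff S

theorem src_baseEdge (e : E) :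
    (𝒢.bassSerreTree S).src (𝒢.baseEdge S e) = 𝒢.baseVertex S (Γ.src e) := rfl

theorem tgt_baseEdge (e : E) :
    (𝒢.bassSerreTree S).tgt (𝒢.baseEdge S e) = 𝒢.letter S e • 𝒢.baseVertex S (Γ.tgt e) := by
  change (⟨Γ.tgt e, ((1 * 𝒢.letter S e : 𝒢.FundamentalGroup S) : _ ⧸ _)⟩ : 𝒢.TreeVertex S) =
    ⟨Γ.tgt e, ((𝒢.letter S e * 1 : 𝒢.FundamentalGroup S) : _ ⧸ _)⟩
  rw [mul_one, one_mul]

/-- The boundary map of the Bass–Serre tree has a primitive, so that the tree has no cycles. -/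
theorem exists_isPrimitive {S : Set E} (hS : Γ.IsSpanningTree S) :
    ∃ f, (𝒢.bassSerreTree S).IsPrimitive (𝒢.FundamentalGroup S) f := by
  obtain ⟨p, hp⟩ := hS.exists_potential (Q := Multiplicative (𝒢.TreeEdge S →₀ ℤ))
    (fun e => Multiplicative.ofAdd (Finsupp.single (𝒢.baseEdge S e) 1))
  let p' : V → (𝒢.TreeEdge S →₀ ℤ) := fun v => (p v).toAdd
  have hp' : ∀ e ∈ S, p' (Γ.tgt e) = p' (Γ.src e) + Finsupp.single (𝒢.baseEdge S e) 1 :=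
    fun e he => congrArg Multiplicative.toAdd (hp e he)
  -- An affine action on edge chains with linear part `edgePerm`: `G_v` fixes the point `p' v`, and
  -- `t_e` sends `p' (tgt e)` to `p' (src e)` plus the base edge. The orbit maps of the points `p'
  -- v` then give the primitive `f`.
  obtain ⟨Ψ, hΨv, hΨt⟩ := 𝒢.exists_hom S (Q := Equiv.Perm (𝒢.TreeEdge S →₀ ℤ))
    (fun v => (MulAut.conj (Equiv.addLeft (p' v))).toMonoidHom.comp ((𝒢.edgePerm S).comp (𝒢.vertexHom S v)))
    (fun e => Equiv.addLeft (p' (Γ.src e) + Finsupp.single (𝒢.baseEdge S e) 1) *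
      𝒢.edgePerm S (𝒢.letter S e) * (Equiv.addLeft (p' (Γ.tgt e)))⁻¹)
    (by
      intro e c
      ext1 m
      have hfix : 𝒢.vertexHom S _ (𝒢.srcHom e c) • 𝒢.baseEdge S e = 𝒢.baseEdge S e :=
        (𝒢.smul_baseEdge_eq_iff S).2 ⟨c, rfl⟩
      have hc := congrArg (𝒢.edgePerm S) (mul_inv_eq_iff_eq_mul.1 (𝒢.letter_conj S e c))
      rw [map_mul, map_mul] at hc
      have hc' := fun n => congrFun (congrArg DFunLike.coe hc) n
      simp only [Equiv.Perm.mul_apply] at hc'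
      simp [Equiv.Perm.mul_apply, MulAut.conj_apply, hc', edgePerm_add, edgePerm_single,
        hfix])
    (by
      intro e he
      rw [letter_eq_one 𝒢 S he, map_one, mul_one, hp' e he, mul_inv_cancel])
  have hadd : ∀ g (m n : (𝒢.TreeEdge S →₀ ℤ)), Ψ g (m + n) = Ψ g m + 𝒢.edgePerm S g n := by
    let H : Subgroup (𝒢.FundamentalGroup S) :=
      { carrier := {g | ∀ m n : (𝒢.TreeEdge S →₀ ℤ), Ψ g (m + n) = Ψ g m + 𝒢.edgePerm S g n}
        one_mem' := fun m n => by simp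
        mul_mem' := fun {a b} ha hb m n => by
          rw [map_mul, map_mul, Equiv.Perm.mul_apply, Equiv.Perm.mul_apply, Equiv.Perm.mul_apply,
            hb, ha]
        inv_mem' := fun {a} ha m n => by
          rw [map_inv, map_inv, Equiv.Perm.inv_eq_iff_eq, ha]
          simp }
    have hH : H = ⊤ := by
      refine 𝒢.eq_top_of_mem S (fun v g m n => ?_) (fun e m n => ?_)
      · rw [hΨv]
        simp only [MonoidHom.comp_apply, MulEquiv.coe_toMonoidHom, MulAut.conj_apply,
          Equiv.Perm.mul_apply]
        simp [edgePerm_add, add_assoc]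
      · rw [hΨt]
        simp [edgePerm_add, add_assoc]
    intro g
    exact (hH ▸ Subgroup.mem_top g : g ∈ H)
  have hpfix : ∀ v, ∀ g ∈ 𝒢.vertexSubgroup S v, Ψ g (p' v) = p' v := by
    rintro v _ ⟨g, rfl⟩
    rw [hΨv]
    have h0 : 𝒢.edgePerm S (𝒢.vertexHom S v g) 0 = 0 :=
      map_zero (Finsupp.domCongr (MulAction.toPerm (𝒢.vertexHom S v g)))
    simp [MulAut.conj_apply, h0]
  let f : 𝒢.TreeVertex S → (𝒢.TreeEdge S →₀ ℤ) := fun x => Quotient.liftOn' x.2 (fun g => Ψ g (p' x.1)) (by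
    intro a b h
    rw [QuotientGroup.leftRel_apply] at h
    have h1 := hpfix x.1 _ h
    change Ψ a (p' x.1) = Ψ b (p' x.1)
    rw [← h1, ← Equiv.Perm.mul_apply, ← map_mul, mul_inv_cancel_left, h1])
  have hf1 : ∀ v, f (𝒢.baseVertex S v) = p' v := fun v => by
    change Ψ 1 (p' v) = p' v
    rw [map_one, Equiv.Perm.one_apply]
  have hfg : ∀ g x, f (g • x) = Ψ g (f x) := by
    rintro g ⟨v, ⟨x⟩⟩
    change Ψ (g * x) (p' v) = Ψ g (Ψ x (p' v))
    rw [map_mul, Equiv.Perm.mul_apply]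
  refine ⟨f, fun ε => ?_, fun g x y ε => ?_⟩
  · obtain ⟨g, e, rfl⟩ := 𝒢.exists_smul_baseEdge S ε
    rw [bassSerreTree_tgt_smul, bassSerreTree_src_smul, hfg, hfg, tgt_baseEdge, src_baseEdge,
      hfg, hf1, hf1, hΨt]
    have h0 : 𝒢.edgePerm S (𝒢.letter S e) 0 = 0 :=
      map_zero (Finsupp.domCongr (MulAction.toPerm (𝒢.letter S e)))
    simp [h0, hadd, edgePerm_single]
  · rw [hfg, hfg]
    have h := hadd g (f y) (f x - f y)
    rw [add_sub_cancel] at h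
    rw [h, add_sub_cancel_left]
    exact 𝒢.edgePerm_apply_smul S g _ ε

theorem isWalk_smul (g : 𝒢.FundamentalGroup S) {l : List (𝒢.TreeEdge S × Bool)}
    {x y : 𝒢.TreeVertex S} (h : (𝒢.bassSerreTree S).IsWalk x l y) :
    ∃ l', (𝒢.bassSerreTree S).IsWalk (g • x) l' (g • y) := by
  induction l generalizing x with
  | nil => exact ⟨[], congrArg (g • ·) h⟩
  | cons d l ih =>
    obtain ⟨l', hl'⟩ := ih h.2
    obtain ⟨ε, b⟩ := d
    refine ⟨(g • ε, b) :: l', ?_, ?_⟩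
    · rw [← h.1]
      cases b
      · exact 𝒢.bassSerreTree_tgt_smul S g ε
      · exact 𝒢.bassSerreTree_src_smul S g ε
    · convert hl' using 1
      cases b
      · exact 𝒢.bassSerreTree_src_smul S g ε
      · exact 𝒢.bassSerreTree_tgt_smul S g ε

/-- The Bass–Serre tree is connected. -/
theorem exists_isWalk {S : Set E} (hS : Γ.IsSpanningTree S) (x y : 𝒢.TreeVertex S) :
    ∃ l, (𝒢.bassSerreTree S).IsWalk x l y := by
  let R : 𝒢.TreeVertex S → 𝒢.TreeVertex S → Prop := fun x y =>
    ∃ l, (𝒢.bassSerreTree S).IsWalk x l y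
  have symm : ∀ {x y}, R x y → R y x := fun ⟨_, h⟩ => OrientedGraph.exists_isWalk_symm h
  have trans : ∀ {x y z}, R x y → R y z → R x z := fun ⟨_, h⟩ ⟨_, h'⟩ =>
    ⟨_, OrientedGraph.isWalk_append.2 ⟨_, h, h'⟩⟩
  have smul : ∀ g {x y}, R x y → R (g • x) (g • y) := fun g _ _ ⟨_, h⟩ => 𝒢.isWalk_smul S g h
  have edge : ∀ e, R (𝒢.baseVertex S (Γ.src e)) (𝒢.letter S e • 𝒢.baseVertex S (Γ.tgt e)) :=
    fun e => ⟨[(𝒢.baseEdge S e, true)], 𝒢.src_baseEdge S e, 𝒢.tgt_baseEdge S e⟩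
  have base : ∀ l (v u : V), Γ.IsWalk v l u → (∀ d ∈ l, d.1 ∈ S) →
      R (𝒢.baseVertex S v) (𝒢.baseVertex S u) := by
    intro l
    induction l with
    | nil =>
      rintro v u h -
      obtain rfl : v = u := h
      exact ⟨[], rfl⟩
    | cons d l ih =>
      rintro v u ⟨rfl, h⟩ hl
      refine trans ?_ (ih _ _ h fun d' hd' => hl d' (List.mem_cons_of_mem _ hd'))
      have h1 := edge d.1
      rw [letter_eq_one 𝒢 S (hl d List.mem_cons_self), one_smul] at h1
      obtain ⟨e, b⟩ := d
      cases b
      · exact symm h1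
      · exact h1
  obtain ⟨⟨r⟩, ht⟩ := hS
  have hr : ∀ v, R (𝒢.baseVertex S r) (𝒢.baseVertex S v) := fun v => by
    obtain ⟨l, ⟨hl, hm⟩, -⟩ := ht r v
    exact base l r v hl.1 hm
  let o := 𝒢.baseVertex S r
  -- The elements moving `o` within its connected component form a subgroup, so it suffices to check
  -- vertex groups and stable letters.
  let H : Subgroup (𝒢.FundamentalGroup S) :=
    { carrier := {g | R o (g • o)}
      one_mem' := ⟨[], (one_smul _ _).symm⟩
      mul_mem' := fun {a b} ha hb => by
        have := smul a hb
        rw [smul_smul] at this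
        exact trans ha this
      inv_mem' := fun {a} ha => by
        have := smul a⁻¹ ha
        rw [inv_smul_smul] at this
        exact symm this }
  have hH : H = ⊤ := by
    refine 𝒢.eq_top_of_mem S (fun v g => ?_) (fun e => ?_)
    · have h := smul (𝒢.vertexHom S v g) (hr v)
      rw [(𝒢.smul_baseVertex_eq_iff S).2 ⟨g, rfl⟩] at h
      exact trans (hr v) (symm h)
    · exact trans (hr _) (trans (edge e) (smul _ (symm (hr _))))
  have ho : ∀ x, R o x := by
    intro x
    obtain ⟨g, v, rfl⟩ := 𝒢.exists_smul_baseVertex S x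
    exact trans (hH ▸ Subgroup.mem_top g : g ∈ H) (smul g (hr v))
  exact trans (symm (ho x)) (ho y)

end GraphOfGroups

/-! ### Generalities on finite generation and conjugacy classes of subgroups. -/

theorem Subgroup.FG.map' {G G' : Type*} [Group G] [Group G'] {K : Subgroup G} (hK : K.FG)
    (f : G →* G') : (K.map f).FG := by
  rw [← Group.fg_iff_subgroup_fg] at hK ⊢
  exact Group.fg_of_surjective (f.subgroupMap_surjective K)

theorem MonoidHom.range_fg {G G' : Type*} [Group G] [Group G'] (hG : Group.FG G) (f : G →* G') :
    f.range.FG :=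
  (Group.fg_iff_subgroup_fg _).1 (Group.fg_range f)

theorem Subgroup.map_conj_map_conj {G : Type*} [Group G] (K : Subgroup G) (a b : G) :
    (K.map (MulAut.conj b).toMonoidHom).map (MulAut.conj a).toMonoidHom =
      K.map (MulAut.conj (a * b)).toMonoidHom := by
  rw [Subgroup.map_map, map_mul]
  rfl

theorem Subgroup.map_conj_one {G : Type*} [Group G] (K : Subgroup G) :
    K.map (MulAut.conj (1 : G)).toMonoidHom = K := by
  rw [map_one]
  exact K.map_id

theorem subgroupConjClass_map_conj {G : Type*} [Group G] {H : Subgroup G} (K : Subgroup G) {h : G}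
    (hh : h ∈ H) :
    subgroupConjClass H (K.map (MulAut.conj h).toMonoidHom) = subgroupConjClass H K := by
  ext L
  constructor
  · rintro ⟨a, ha, rfl⟩
    exact ⟨a * h, H.mul_mem ha hh, K.map_conj_map_conj a h⟩
  · rintro ⟨a, ha, rfl⟩
    exact ⟨a * h⁻¹, H.mul_mem ha (H.inv_mem hh), by rw [Subgroup.map_conj_map_conj, inv_mul_cancel_right]⟩

/-! ### Transfer of the free group results to embedded free groups. -/

namespace FreeGroup

variable {α G : Type*} [Group G] {φ : FreeGroup α →* G}

theorem eq_bot_of_finite_of_le_range (hφ : Function.Injective φ) {K : Subgroup G}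
    (hK : K ≤ φ.range) (hfin : Finite K) : K = ⊥ := by
  refine (Subgroup.eq_bot_iff_forall K).2 fun k hk => ?_
  obtain ⟨w, rfl⟩ := hK hk
  have h : IsOfFinOrder (φ w) :=
    K.subtype.isOfFinOrder (isOfFinOrder_of_finite (⟨φ w, hk⟩ : K))
  rw [(isOfFinOrder_iff_eq_one w).1 (hφ.isOfFinOrder_iff.1 h)]
  exact φ.map_one

theorem fg_comap (hφ : Function.Injective φ) {K : Subgroup G} (hK : K ≤ φ.range) (hfg : K.FG) :
    (K.comap φ).FG := by
  rw [← Subgroup.map_comap_eq_self hK, ← Group.fg_iff_subgroup_fg] at hfg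
  rw [← Group.fg_iff_subgroup_fg]
  exact Group.fg_of_surjective
    (f := ((K.comap φ).equivMapOfInjective φ hφ).symm.toMonoidHom)
    ((K.comap φ).equivMapOfInjective φ hφ).symm.surjective

/-- Howson's theorem for subgroups of an embedded free group. -/
theorem fg_inf_of_le_range [Finite α] (hφ : Function.Injective φ) {H K : Subgroup G}
    (hH : H ≤ φ.range) (hK : K ≤ φ.range) (hHfg : H.FG) (hKfg : K.FG) : (H ⊓ K).FG := by
  have h := (fg_inf (fg_comap hφ hH hHfg) (fg_comap hφ hK hKfg)).map' φ
  rwa [← Subgroup.comap_inf, Subgroup.map_comap_eq_self (inf_le_left.trans hH)] at h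

/-- An embedded free group contains, up to conjugacy, only finitely many infinite intersections of
conjugates of finitely many given finitely generated subgroups. -/
theorem finite_conjClass_sInf (hφ : Function.Injective φ) {ι : Type*} [Finite ι]
    (H : ι → Subgroup G) (hH : ∀ i, H i ≤ φ.range) (hfg : ∀ i, (H i).FG) :
    (subgroupConjClass φ.range '' {K : Subgroup G | Infinite K ∧ ∃ 𝒞 : Set (Subgroup G),
      (∀ L ∈ 𝒞, ∃ i, ∃ g ∈ φ.range, L = (H i).map (MulAut.conj g).toMonoidHom) ∧
      K = φ.range ⊓ sInf 𝒞}).Finite := by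
  obtain ⟨𝒦, h𝒦, hex⟩ := exists_finite_conj_fixingSubgroup (fun i => (H i).comap φ)
    fun i => fg_comap hφ (hH i) (hfg i)
  refine (h𝒦.image fun K => subgroupConjClass φ.range (K.map φ)).subset ?_
  rintro _ ⟨K, ⟨hinf, 𝒞, h𝒞, hK⟩, rfl⟩
  -- The conjugate of `H i` by `φ g` meets the free group in the stabilizer of the coset of `g`, so
  -- intersecting the members of `𝒞` amounts to fixing all these cosets.
  let A : Set (Σ i, FreeGroup α ⧸ (H i).comap φ) :=
    {x | ∃ g : FreeGroup α, x.2 = g ∧ (H x.1).map (MulAut.conj (φ g)).toMonoidHom ∈ 𝒞}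
  have hKr : K ≤ φ.range := hK ▸ inf_le_left
  have hstab : ∀ (i : ι) (g w : FreeGroup α),
      w • (⟨i, (g : FreeGroup α ⧸ (H i).comap φ)⟩ : Σ i, FreeGroup α ⧸ (H i).comap φ) =
        ⟨i, (g : FreeGroup α ⧸ (H i).comap φ)⟩ ↔
      φ w ∈ (H i).map (MulAut.conj (φ g)).toMonoidHom := by
    intro i g w
    change (⟨i, ((w * g : FreeGroup α) : FreeGroup α ⧸ (H i).comap φ)⟩ :
      Σ i, FreeGroup α ⧸ (H i).comap φ) = ⟨i, _⟩ ↔ _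
    rw [Sigma.mk.injEq, heq_eq_eq, eq_comm (a := QuotientGroup.mk _), QuotientGroup.eq,
      Subgroup.mem_comap, Subgroup.mem_map_equiv, MulAut.conj_symm_apply]
    simp only [true_and, MonoidHom.map_mul, MonoidHom.map_inv, mul_assoc]
  have hcomap : K.comap φ = fixingSubgroup (FreeGroup α) A := by
    ext w
    rw [mem_fixingSubgroup_iff, Subgroup.mem_comap, hK, Subgroup.mem_inf, Subgroup.mem_sInf]
    constructor
    · rintro ⟨-, h⟩ ⟨i, x⟩ ⟨g, hg, hmem⟩
      obtain rfl : x = g := hg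
      exact (hstab i g w).2 (h _ hmem)
    · refine fun h => ⟨⟨w, rfl⟩, fun L hL => ?_⟩
      obtain ⟨i, _, ⟨g, rfl⟩, rfl⟩ := h𝒞 L hL
      exact (hstab i g w).1 (h ⟨i, (g : FreeGroup α ⧸ (H i).comap φ)⟩ ⟨g, rfl, hL⟩)
  have hne : fixingSubgroup (FreeGroup α) A ≠ ⊥ := by
    rw [← hcomap]
    intro hbot
    have h1 := Subgroup.map_comap_eq_self hKr
    rw [hbot, Subgroup.map_bot] at h1
    rw [← h1] at hinf
    exact not_finite (⊥ : Subgroup G)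
  obtain ⟨c, hc⟩ := hex A hne
  refine ⟨_, hc, ?_⟩
  have hconj : φ.comp (MulAut.conj c).toMonoidHom = (MulAut.conj (φ c)).toMonoidHom.comp φ := by
    ext w
    simp
  change subgroupConjClass φ.range (Subgroup.map φ _) = _
  rw [Subgroup.map_map, hconj, ← Subgroup.map_map, ← hcomap, Subgroup.map_comap_eq_self hKr,
    subgroupConjClass_map_conj K (MonoidHom.mem_range.2 ⟨c, rfl⟩)]

end FreeGroup

/-! ### Stabilizers in the tree and the two implications. -/

namespace GraphOfGroups

variable {V E : Type*} {Γ : OrientedGraph V E} (𝒢 : GraphOfGroups Γ) {S : Set E}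

theorem stabilizer_smul_baseVertex (g : 𝒢.FundamentalGroup S) (v : V) :
    MulAction.stabilizer (𝒢.FundamentalGroup S) (g • 𝒢.baseVertex S v) =
      (𝒢.vertexSubgroup S v).map (MulAut.conj g).toMonoidHom := by
  rw [MulAction.stabilizer_smul_eq_stabilizer_map_conj, stabilizer_baseVertex]

/-- The stabilizers of vertices of the Bass–Serre tree are free of finite rank if the vertex groups
are. -/
theorem exists_freeGroup_hom (hfree : ∀ v, IsFreeGroup (𝒢.vertexGroup v))
    (hvertex : ∀ v, Group.FG (𝒢.vertexGroup v)) (hS : Γ.IsSpanningTree S) (x : 𝒢.TreeVertex S) :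
    ∃ (n : ℕ) (φ : FreeGroup (Fin n) →* 𝒢.FundamentalGroup S), Function.Injective φ ∧
      φ.range = MulAction.stabilizer (𝒢.FundamentalGroup S) x := by
  obtain ⟨g, v, rfl⟩ := 𝒢.exists_smul_baseVertex S x
  have := hfree v
  have := hvertex v
  let e₀ := IsFreeGroup.toFreeGroup (𝒢.vertexGroup v)
  have := FreeGroup.finite_of_fg (Group.fg_of_surjective (f := e₀.toMonoidHom) e₀.surjective)
  obtain ⟨n, ⟨ι⟩⟩ := Finite.exists_equiv_fin (IsFreeGroup.Generators (𝒢.vertexGroup v))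
  let e := e₀.trans (FreeGroup.freeGroupCongr ι)
  refine ⟨n, (MulAut.conj g).toMonoidHom.comp ((𝒢.vertexHom S v).comp e.symm.toMonoidHom),
    ?_, ?_⟩
  · exact (MulAut.conj g).injective.comp ((𝒢.vertexHom_injective hS v).comp e.symm.injective)
  · rw [stabilizer_smul_baseVertex, MonoidHom.range_comp, MonoidHom.range_comp,
      MonoidHom.range_eq_top.2 e.symm.surjective, ← MonoidHom.range_eq_map]
    rfl

theorem stabilizer_edge_fg (hedge : ∀ e, Group.FG (𝒢.edgeGroup e)) (ε : 𝒢.TreeEdge S) :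
    (MulAction.stabilizer (𝒢.FundamentalGroup S) ε).FG := by
  obtain ⟨g, e, rfl⟩ := 𝒢.exists_smul_baseEdge S ε
  rw [MulAction.stabilizer_smul_eq_stabilizer_map_conj, stabilizer_baseEdge]
  exact (MonoidHom.range_fg (hedge e) _).map' _

theorem stabilizer_vertex_fg (hvertex : ∀ v, Group.FG (𝒢.vertexGroup v)) (x : 𝒢.TreeVertex S) :
    (MulAction.stabilizer (𝒢.FundamentalGroup S) x).FG := by
  obtain ⟨g, v, rfl⟩ := 𝒢.exists_smul_baseVertex S x
  rw [stabilizer_smul_baseVertex]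
  exact (MonoidHom.range_fg (hvertex v) _).map' _

/-- The stabilizer of an edge of the Bass–Serre tree is the intersection of the stabilizers of its
end points. -/
theorem stabilizer_edge_eq (hS : Γ.IsSpanningTree S) (ε : 𝒢.TreeEdge S) :
    MulAction.stabilizer (𝒢.FundamentalGroup S) ε =
      MulAction.stabilizer (𝒢.FundamentalGroup S) ((𝒢.bassSerreTree S).src ε) ⊓
        MulAction.stabilizer (𝒢.FundamentalGroup S) ((𝒢.bassSerreTree S).tgt ε) := by
  obtain ⟨f, hf⟩ := 𝒢.exists_isPrimitive hS
  ext g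
  rw [Subgroup.mem_inf, MulAction.mem_stabilizer_iff, MulAction.mem_stabilizer_iff,
    MulAction.mem_stabilizer_iff]
  constructor
  · intro h
    rw [← bassSerreTree_src_smul, ← bassSerreTree_tgt_smul, h]
    exact ⟨rfl, rfl⟩
  · exact fun h => hf.smul_edge_eq h.1 h.2

theorem mem_pathStab_iff {l : List (𝒢.TreeEdge S × Bool)} {g : 𝒢.FundamentalGroup S} :
    g ∈ 𝒢.pathStab S l ↔ ∀ d ∈ l, g • d.1 = d.1 := by
  simp [pathStab, Subgroup.mem_iInf, MulAction.mem_stabilizer_iff]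

theorem pathStab_cons (d : 𝒢.TreeEdge S × Bool) (l : List (𝒢.TreeEdge S × Bool)) :
    𝒢.pathStab S (d :: l) =
      MulAction.stabilizer (𝒢.FundamentalGroup S) d.1 ⊓ 𝒢.pathStab S l := by
  ext g
  rw [Subgroup.mem_inf, mem_pathStab_iff, mem_pathStab_iff, List.forall_mem_cons,
    MulAction.mem_stabilizer_iff]

theorem smul_dartStart_eq {g : 𝒢.FundamentalGroup S} {d : 𝒢.TreeEdge S × Bool}
    (h : g • d.1 = d.1) :
    g • (𝒢.bassSerreTree S).dartStart d = (𝒢.bassSerreTree S).dartStart d := by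
  unfold OrientedGraph.dartStart
  split_ifs
  · rw [← bassSerreTree_src_smul, h]
  · rw [← bassSerreTree_tgt_smul, h]

theorem smul_dartEnd_eq {g : 𝒢.FundamentalGroup S} {d : 𝒢.TreeEdge S × Bool}
    (h : g • d.1 = d.1) :
    g • (𝒢.bassSerreTree S).dartEnd d = (𝒢.bassSerreTree S).dartEnd d := by
  unfold OrientedGraph.dartEnd
  split_ifs
  · rw [← bassSerreTree_tgt_smul, h]
  · rw [← bassSerreTree_src_smul, h]

theorem smul_eq_of_mem_pathStab {g : 𝒢.FundamentalGroup S} {x y : 𝒢.TreeVertex S}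
    {l : List (𝒢.TreeEdge S × Bool)} (h : (𝒢.bassSerreTree S).IsWalk x l y)
    (hg : g ∈ 𝒢.pathStab S l) (hx : g • x = x) : g • y = y := by
  induction l generalizing x with
  | nil =>
    obtain rfl : x = y := h
    exact hx
  | cons d l ih =>
    rw [pathStab_cons] at hg
    exact ih h.2 hg.2 (𝒢.smul_dartEnd_eq hg.1)

/-- The stabilizer of a nonempty path fixes all its vertices, so the choice of vertex is immaterial.
For the empty path `pathStab` is the whole group, but then `x` is the only vertex. -/
theorem stabilizer_inf_pathStab_eq {x y z : 𝒢.TreeVertex S}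
    {l : List (𝒢.TreeEdge S × Bool)} (h : (𝒢.bassSerreTree S).IsWalk x l y)
    (hz : z ∈ (𝒢.bassSerreTree S).support x l) :
    MulAction.stabilizer (𝒢.FundamentalGroup S) z ⊓ 𝒢.pathStab S l =
      MulAction.stabilizer (𝒢.FundamentalGroup S) x ⊓ 𝒢.pathStab S l := by
  rcases List.mem_cons.1 hz with rfl | hz
  · rfl
  obtain ⟨d, hd, rfl⟩ := List.mem_map.1 hz
  have h1 : 𝒢.pathStab S l ≤ MulAction.stabilizer (𝒢.FundamentalGroup S)
      ((𝒢.bassSerreTree S).dartEnd d) := fun g hg =>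
    𝒢.smul_dartEnd_eq (𝒢.mem_pathStab_iff.1 hg d hd)
  have h2 : 𝒢.pathStab S l ≤ MulAction.stabilizer (𝒢.FundamentalGroup S) x := by
    rcases l with _ | ⟨d', l⟩
    · simp at hd
    · intro g hg
      rw [← h.1]
      exact 𝒢.smul_dartStart_eq (𝒢.mem_pathStab_iff.1 hg d' List.mem_cons_self)
  rw [inf_eq_right.2 h1, inf_eq_right.2 h2]

/-- Prepending an edge intersects the previous group with an edge stabilizer, and both lie in the
free stabilizer of the vertex where they meet, so Howson's theorem applies at each edge. -/
theorem stabilizer_inf_pathStab_fg (hfree : ∀ v, IsFreeGroup (𝒢.vertexGroup v))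
    (hvertex : ∀ v, Group.FG (𝒢.vertexGroup v)) (hedge : ∀ e, Group.FG (𝒢.edgeGroup e))
    (hS : Γ.IsSpanningTree S) {x y : 𝒢.TreeVertex S} {l : List (𝒢.TreeEdge S × Bool)}
    (h : (𝒢.bassSerreTree S).IsWalk x l y) :
    (MulAction.stabilizer (𝒢.FundamentalGroup S) x ⊓ 𝒢.pathStab S l).FG := by
  induction l generalizing x with
  | nil =>
    have : 𝒢.pathStab S [] = ⊤ := by simp [pathStab]
    rw [this, inf_top_eq]
    exact 𝒢.stabilizer_vertex_fg hvertex x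
  | cons d l ih =>
    have heq : MulAction.stabilizer (𝒢.FundamentalGroup S) x ⊓ 𝒢.pathStab S (d :: l) =
        MulAction.stabilizer (𝒢.FundamentalGroup S) d.1 ⊓
          (MulAction.stabilizer (𝒢.FundamentalGroup S) ((𝒢.bassSerreTree S).dartEnd d) ⊓
            𝒢.pathStab S l) := by
      rw [pathStab_cons]
      ext g
      simp only [Subgroup.mem_inf, MulAction.mem_stabilizer_iff]
      constructor
      · exact fun hg => ⟨hg.2.1, 𝒢.smul_dartEnd_eq hg.2.1, hg.2.2⟩
      · exact fun hg => ⟨h.1 ▸ 𝒢.smul_dartStart_eq hg.1, hg.1, hg.2.2⟩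
    obtain ⟨n, φ, hφ, hr⟩ := 𝒢.exists_freeGroup_hom hfree hvertex hS
      ((𝒢.bassSerreTree S).dartEnd d)
    rw [heq]
    refine FreeGroup.fg_inf_of_le_range hφ ?_ ?_ (𝒢.stabilizer_edge_fg hedge _) (ih h.2)
    · rw [hr]
      exact fun g hg => 𝒢.smul_dartEnd_eq hg
    · rw [hr]
      exact inf_le_left

/-- The path is a geodesic from `x` to `y`: an element fixing both ends fixes every edge of it. -/
theorem exists_pathStabilizer_eq (hS : Γ.IsSpanningTree S) (x y : 𝒢.TreeVertex S) :
    (x, MulAction.stabilizer (𝒢.FundamentalGroup S) x ⊓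
      MulAction.stabilizer (𝒢.FundamentalGroup S) y) ∈ 𝒢.pathStabilizers S := by
  obtain ⟨l₀, h₀⟩ := 𝒢.exists_isWalk hS x y
  obtain ⟨l, hl⟩ := OrientedGraph.exists_isGeodesic h₀
  obtain ⟨f, hf⟩ := 𝒢.exists_isPrimitive hS
  refine ⟨x, l, y, hl.isPath, List.mem_cons_self, ?_⟩
  ext g
  rw [Subgroup.mem_inf, Subgroup.mem_inf]
  refine and_congr_right fun hx => ⟨fun hy => ?_, fun hg => ?_⟩
  · exact 𝒢.mem_pathStab_iff.2 (hf.smul_eq_of_mem_geodesic (𝒢.bassSerreTree_src_smul S)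
      (𝒢.bassSerreTree_tgt_smul S) hl hx hy)
  · exact 𝒢.smul_eq_of_mem_pathStab hl.1 hg hx

/-- Fixing an edge is the same as fixing its two ends, so `A` can be the set of ends of edges of the
path. -/
theorem exists_eq_inf_fixingSubgroup (hS : Γ.IsSpanningTree S)
    {p : 𝒢.TreeVertex S × Subgroup (𝒢.FundamentalGroup S)} (hp : p ∈ 𝒢.pathStabilizers S) :
    ∃ A : Set (𝒢.TreeVertex S), p.2 = MulAction.stabilizer (𝒢.FundamentalGroup S) p.1 ⊓
      fixingSubgroup (𝒢.FundamentalGroup S) A := by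
  obtain ⟨x, l, y, -, -, hK⟩ := hp
  refine ⟨{z | ∃ d ∈ l, z = (𝒢.bassSerreTree S).src d.1 ∨ z = (𝒢.bassSerreTree S).tgt d.1}, ?_⟩
  rw [hK]
  congr 1
  ext g
  rw [mem_pathStab_iff, mem_fixingSubgroup_iff]
  constructor
  · rintro h z ⟨d, hd, rfl | rfl⟩
    · rw [← bassSerreTree_src_smul, h d hd]
    · rw [← bassSerreTree_tgt_smul, h d hd]
  · intro h d hd
    have : g ∈ MulAction.stabilizer (𝒢.FundamentalGroup S) d.1 := by
      rw [𝒢.stabilizer_edge_eq hS]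
      exact ⟨h _ ⟨d, hd, Or.inl rfl⟩, h _ ⟨d, hd, Or.inr rfl⟩⟩
    exact this

theorem conjClass_smul (g : 𝒢.FundamentalGroup S)
    (p : 𝒢.TreeVertex S × Subgroup (𝒢.FundamentalGroup S)) :
    𝒢.conjClass S (g • p.1, p.2.map (MulAut.conj g).toMonoidHom) = 𝒢.conjClass S p := by
  ext q
  constructor
  · rintro ⟨a, rfl⟩
    exact ⟨a * g, by rw [Subgroup.map_conj_map_conj, smul_smul]⟩
  · rintro ⟨a, rfl⟩
    exact ⟨a * g⁻¹, by rw [Subgroup.map_conj_map_conj, smul_smul, inv_mul_cancel_right]⟩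

theorem mem_conjClass_self (p : 𝒢.TreeVertex S × Subgroup (𝒢.FundamentalGroup S)) :
    p ∈ 𝒢.conjClass S p := by
  exact ⟨1, by rw [one_smul, Subgroup.map_conj_one]⟩

/-- Every path stabilizer is conjugate to one considered at a base vertex, which is an intersection
of a vertex group with vertex stabilizers. -/
theorem exists_conjClass_eq_baseVertex (hS : Γ.IsSpanningTree S)
    {p : 𝒢.TreeVertex S × Subgroup (𝒢.FundamentalGroup S)} (hp : p ∈ 𝒢.pathStabilizers S) :
    ∃ (v : V) (A : Set (𝒢.TreeVertex S)), 𝒢.conjClass S p = 𝒢.conjClass S (𝒢.baseVertex S v,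
      𝒢.vertexSubgroup S v ⊓ fixingSubgroup (𝒢.FundamentalGroup S) A) := by
  obtain ⟨A, hA⟩ := 𝒢.exists_eq_inf_fixingSubgroup hS hp
  obtain ⟨x, K⟩ := p
  obtain ⟨g, v, rfl⟩ := 𝒢.exists_smul_baseVertex S x
  refine ⟨v, (fun z => g⁻¹ • z) '' A, ?_⟩
  suffices hK : K = (𝒢.vertexSubgroup S v ⊓ fixingSubgroup (𝒢.FundamentalGroup S)
      ((fun z => g⁻¹ • z) '' A)).map (MulAut.conj g).toMonoidHom by
    rw [hK]
    exact 𝒢.conjClass_smul g (_, _)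
  change K = _ at hA
  rw [hA]
  ext h
  rw [Subgroup.mem_map_equiv, MulAut.conj_symm_apply, Subgroup.mem_inf, Subgroup.mem_inf,
    mem_fixingSubgroup_iff, mem_fixingSubgroup_iff, Set.forall_mem_image, stabilizer_smul_baseVertex,
    Subgroup.mem_map_equiv, MulAut.conj_symm_apply]
  refine and_congr_right fun _ => forall₂_congr fun z _ => ?_
  rw [mul_smul, mul_smul, smul_inv_smul, smul_left_cancel_iff]

theorem finite_conjClass_of_finiteStature [Finite V]
    (hfree : ∀ v, IsFreeGroup (𝒢.vertexGroup v)) (hvertex : ∀ v, Group.FG (𝒢.vertexGroup v))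
    (hS : Γ.IsSpanningTree S) (h : FiniteStature (fun v : V => 𝒢.vertexSubgroup S v)) :
    (𝒢.conjClass S '' 𝒢.pathStabilizers S).Finite := by
  -- `G_v` fixes the base vertex, so `G_v`-conjugate subgroups give the same `G`-class of pairs. The
  -- union thus collapses, and `Φ v` turns `G_v`-classes into `G`-classes.
  let Φ : V → Set (Subgroup (𝒢.FundamentalGroup S)) →
      Set (𝒢.TreeVertex S × Subgroup (𝒢.FundamentalGroup S)) := fun v c =>
    ⋃ K ∈ c, 𝒢.conjClass S (𝒢.baseVertex S v, K)
  have hΦ : ∀ v K, Φ v (subgroupConjClass (𝒢.vertexSubgroup S v) K) =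
      𝒢.conjClass S (𝒢.baseVertex S v, K) := by
    intro v K
    have hcl : ∀ L ∈ subgroupConjClass (𝒢.vertexSubgroup S v) K,
        𝒢.conjClass S (𝒢.baseVertex S v, L) = 𝒢.conjClass S (𝒢.baseVertex S v, K) := by
      rintro _ ⟨a, ha, rfl⟩
      have := 𝒢.conjClass_smul a (𝒢.baseVertex S v, K)
      rwa [(𝒢.smul_baseVertex_eq_iff S).2 ha] at this
    refine Set.Subset.antisymm (Set.iUnion₂_subset fun L hL => (hcl L hL).subset) ?_
    exact Set.subset_iUnion₂_of_subset K ⟨1, Subgroup.one_mem _, K.map_conj_one.symm⟩ subset_rfl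
  refine Set.Finite.subset (Set.finite_iUnion fun v => ((h v).image (Φ v)).insert
    (𝒢.conjClass S (𝒢.baseVertex S v, ⊥))) ?_
  rintro _ ⟨p, hp, rfl⟩
  obtain ⟨v, A, hA⟩ := 𝒢.exists_conjClass_eq_baseVertex hS hp
  rw [hA]
  refine Set.mem_iUnion.2 ⟨v, ?_⟩
  set K := 𝒢.vertexSubgroup S v ⊓ fixingSubgroup (𝒢.FundamentalGroup S) A with hK
  rcases finite_or_infinite K with hfin | hinf
  · left
    obtain ⟨n, φ, hφ, hr⟩ := 𝒢.exists_freeGroup_hom hfree hvertex hS (𝒢.baseVertex S v)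
    rw [stabilizer_baseVertex] at hr
    rw [FreeGroup.eq_bot_of_finite_of_le_range hφ (hr ▸ inf_le_left : K ≤ φ.range) hfin]
  · right
    refine ⟨_, ⟨K, ⟨hinf, MulAction.stabilizer (𝒢.FundamentalGroup S) '' A, ?_, ?_⟩, rfl⟩,
      hΦ v K⟩
    · rintro _ ⟨z, -, rfl⟩
      obtain ⟨g, u, rfl⟩ := 𝒢.exists_smul_baseVertex S z
      exact ⟨u, g, 𝒢.stabilizer_smul_baseVertex g u⟩
    · rw [hK]
      congr 1
      ext g
      rw [mem_fixingSubgroup_iff, Subgroup.mem_sInf, Set.forall_mem_image]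
      rfl

theorem finiteStature_of_finite_conjClass
    (hfree : ∀ v, IsFreeGroup (𝒢.vertexGroup v)) (hvertex : ∀ v, Group.FG (𝒢.vertexGroup v))
    (hedge : ∀ e, Group.FG (𝒢.edgeGroup e)) (hS : Γ.IsSpanningTree S)
    (h : (𝒢.conjClass S '' 𝒢.pathStabilizers S).Finite) :
    FiniteStature (fun v : V => 𝒢.vertexSubgroup S v) := by
  intro v
  let P : Set (Subgroup (𝒢.FundamentalGroup S)) :=
    {K | (𝒢.baseVertex S v, K) ∈ 𝒢.pathStabilizers S}
  let cl : Subgroup (𝒢.FundamentalGroup S) →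
      Set (𝒢.TreeVertex S × Subgroup (𝒢.FundamentalGroup S)) :=
    fun K => 𝒢.conjClass S (𝒢.baseVertex S v, K)
  have hfin : (cl '' P).Finite := h.subset (by
    rintro _ ⟨K, hK, rfl⟩
    exact ⟨_, hK, rfl⟩)
  have := hfin.to_subtype
  have hrep : ∀ c : cl '' P, ∃ K ∈ P, cl K = c := fun c => c.2
  -- `H` is a finite family of representatives of the path stabilizers at the base vertex of `v`.
  choose H hHP hHc using hrep
  obtain ⟨n, φ, hφ, hr⟩ := 𝒢.exists_freeGroup_hom hfree hvertex hS (𝒢.baseVertex S v)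
  rw [stabilizer_baseVertex] at hr
  have hP : ∀ K ∈ P, K ≤ φ.range ∧ K.FG := by
    rintro K ⟨x, l, y, hl, hz, hK⟩
    change K = _ at hK
    rw [hK]
    constructor
    · rw [hr, ← stabilizer_baseVertex]
      exact inf_le_left
    · rw [𝒢.stabilizer_inf_pathStab_eq hl.1 hz]
      exact 𝒢.stabilizer_inf_pathStab_fg hfree hvertex hedge hS hl.1
  have hmain := FreeGroup.finite_conjClass_sInf hφ H (fun c => (hP _ (hHP c)).1)
    (fun c => (hP _ (hHP c)).2)
  rw [hr] at hmain
  refine hmain.subset (Set.image_mono ?_)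
  rintro K ⟨hinf, 𝒞, h𝒞, hK⟩
  -- Intersecting each member with `G_v` does not change `G_v ∩ C`, and makes each member a path
  -- stabilizer, hence a conjugate of some `H c`.
  refine ⟨hinf, (fun L => 𝒢.vertexSubgroup S v ⊓ L) '' 𝒞, ?_, ?_⟩
  · rintro _ ⟨L, hL, rfl⟩
    obtain ⟨u, g, rfl⟩ := h𝒞 L hL
    have hmem : 𝒢.vertexSubgroup S v ⊓
        (𝒢.vertexSubgroup S u).map (MulAut.conj g).toMonoidHom ∈ P := by
      have := 𝒢.exists_pathStabilizer_eq hS (𝒢.baseVertex S v) (g • 𝒢.baseVertex S u)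
      rwa [stabilizer_baseVertex, stabilizer_smul_baseVertex] at this
    refine ⟨⟨_, _, hmem, rfl⟩, ?_⟩
    have h1 := 𝒢.mem_conjClass_self (𝒢.baseVertex S v, 𝒢.vertexSubgroup S v ⊓
        (𝒢.vertexSubgroup S u).map (MulAut.conj g).toMonoidHom)
    have h2 := hHc ⟨_, _, hmem, rfl⟩
    change cl _ = cl _ at h2
    change _ ∈ cl _ at h1
    rw [← h2] at h1
    obtain ⟨a, ha⟩ := h1
    -- Since the pairs record the vertex, the conjugating element fixes the base vertex and so lies
    -- in `G_v`.
    exact ⟨a, (𝒢.smul_baseVertex_eq_iff S).1 (congrArg Prod.fst ha).symm, congrArg Prod.snd ha⟩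
  · change K = 𝒢.vertexSubgroup S v ⊓ _ at hK
    rw [hK]
    ext g
    simp only [Subgroup.mem_inf, Subgroup.mem_sInf, Set.forall_mem_image]
    exact and_congr_right fun hg => forall₂_congr fun L _ => (and_iff_right hg).symm

end GraphOfGroups

theorem mainTheorem7 {V E : Type*} [Finite V] (Γ : OrientedGraph V E) (𝒢 : GraphOfGroups Γ)
    (hfree : ∀ v, IsFreeGroup (𝒢.vertexGroup v))
    (hvertex : ∀ v, Group.FG (𝒢.vertexGroup v))
    (hedge : ∀ e, Group.FG (𝒢.edgeGroup e))
    (S : Set E) (hS : Γ.IsSpanningTree S) :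
    FiniteStature (fun v : V => 𝒢.vertexSubgroup S v) ↔
      (𝒢.conjClass S '' 𝒢.pathStabilizers S).Finite :=
  ⟨𝒢.finite_conjClass_of_finiteStature hfree hvertex hS,
    𝒢.finiteStature_of_finite_conjClass hfree hvertex hedge hS⟩
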